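/- A straight-line drawing of a rooted tree on the integer grid $\{1,\dots,W\}\times\{1,\dots,H\}$ maps the vertices to distinct grid points and each edge to the straight line segment between the images of its ends; it is required to be planar: the segment of an edge contains the image of no vertex other than its two ends, and the segments of two distinct edges have no point in common except the image of a common end. Its width is $W$ and its height is $H$. The drawing is upward if the $y$-coordinate of each node is greater than or equal to the $y$-coordinate of each of its children. Theorem. There is an absolute constant $C>0$ such that for every integer $n$ and every real number $A$ with $n\ge A\ge 1$, every rooted tree with $n$ vertices (of arbitrary degrees) has a planar straight-line upward drawing on an integer grid with width at most $C\,(A+\log n)$ and height at most $C\,\dfrac{n}{\sqrt A}\,\log^2(A+1)$, in which the root is placed at the top left corner of the bounding box of the drawing. -/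

import Mathlib

namespace TreeDrawing

/-- An integer grid point, seen as a point of the real plane. -/
def toPlane (p : ℤ × ℤ) : ℝ × ℝ := ((p.1 : ℝ), (p.2 : ℝ))

/-- The closed straight-line segment joining the grid points `p` and `q`. -/
def seg (p q : ℤ × ℤ) : Set (ℝ × ℝ) := segment ℝ (toPlane p) (toPlane q)

/-- `pos` is a planar straight-line drawing of the graph `G` on the integer grid
`{1, …, W} × {1, …, H}` (`W` columns and `H` rows): distinct vertices are drawn at distinct grid
points, the segment representing an edge passes through no vertex but its two ends, and the
segments representing two distinct edges meet at most in the image of a common end. -/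
structure IsPlanarGridDrawing {V : Type*} (G : SimpleGraph V) (pos : V → ℤ × ℤ) (W H : ℕ) :
    Prop where
  mem_grid : ∀ v, (pos v).1 ∈ Set.Icc (1 : ℤ) W ∧ (pos v).2 ∈ Set.Icc (1 : ℤ) H
  injective : Function.Injective pos
  vertex_on_edge : ∀ u v w, G.Adj u v → toPlane (pos w) ∈ seg (pos u) (pos v) → w = u ∨ w = v
  edge_inter : ∀ a b c d, G.Adj a b → G.Adj c d → s(a, b) ≠ s(c, d) →
    ∀ p, p ∈ seg (pos a) (pos b) → p ∈ seg (pos c) (pos d) →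
      ∃ v, (v = a ∨ v = b) ∧ (v = c ∨ v = d) ∧ p = toPlane (pos v)

/-- In the tree `G` rooted at `r`, the node `v` is a child of the node `u`: the two are adjacent
and `v` is one step further away from the root. -/
def IsChild {V : Type*} (G : SimpleGraph V) (r u v : V) : Prop :=
  G.Adj u v ∧ G.dist r v = G.dist r u + 1

/-- Upward drawing of a rooted tree: the `y`-coordinate of each node is greater than or equal to
the `y`-coordinate of each of its children. -/
def IsUpward {V : Type*} (G : SimpleGraph V) (r : V) (pos : V → ℤ × ℤ) : Prop :=
  ∀ u v, IsChild G r u v → (pos v).2 ≤ (pos u).2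

/-- The vertex `r` is drawn at the top left corner of the bounding box of the drawing, that is,
of the smallest axis-parallel rectangle that contains all vertices (hence all edges). -/
def AtTopLeft {V : Type*} (r : V) (pos : V → ℤ × ℤ) : Prop :=
  ∀ v, (pos r).1 ≤ (pos v).1 ∧ (pos v).2 ≤ (pos r).2

end TreeDrawing

/-! Take `K = ⌈√A⌉₊ + 1` and draw with the root at the origin and children downwards (second
coordinate weakly increasing); a reflection at the end puts the root at the top left. Call a subtree
large if it has more than `K ^ 2` nodes. The target is width `3 * K ^ 2 + log₂ n` and height of
order `gam K * (n / K + K)`, which `exists_box` provides.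

A tree with `s` nodes fits in `s` columns and `log₂ s + 1` rows (`exists_horizontal`): the heaviest
child continues the row of its parent and the other children hang one row lower, so each new row
halves the size. This drawing is monotone in `x`, hence may be sheared vertically without destroying
upwardness.

A node with many small child subtrees cannot simply stack them, since each would cost a row. Instead
the tiny ones, of size at most `a` with `a` of order at least `K / log K`, are placed in a fan
(`exists_fan`). Along a direction of slope `p / q` with `a ≤ q ≤ K` there are `K` lattice positions,
horizontally `q` apart, each receiving one sheared drawing. Such a bundle occupies a wedge of
angular width proportional to its largest size divided by `K ^ 2`, so what is needed is a supply of
slopes spaced by about `1 / K ^ 2`. Fractions with distinct prime denominators differ by at least `1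
/ K ^ 2`, and Chebyshev's bound makes them dense enough up to a factor `log² K`; this is the source
of the squared logarithm. Total fan height is `O(K log K + (L / K) log² K)` for tiny subtrees with
`L` nodes in all. The remaining subtrees are stacked below the fan (`exists_fan_stack`); all but the
heaviest child move one column to the right, which costs `log₂ n` columns over the whole recursion.

The additive term of order `K log K` must not be paid at every node. It is affordable if the node
has at least two large children, or small child subtrees with at least `K ^ 2` nodes in total; the
negative constant in `heightBound` is the potential that pays for it. All other nodes have exactly
one large child and few small descendants. Chains of them are drawn as runs (`RunDraws`) inside one
horizontal strip of `O(log K)` rows, and a run is closed once its strip holds `K ^ 2` nodes, which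
pay for the strip. `exists_box_and_run` carries both kinds of drawing through one induction from the
leaves. -/

namespace TreeDrawing

open Relation

/-! ### Rooted forests -/

/-- A rooted forest given by its child relation: every node has at most one parent, and the rank
of a node is one more than the rank of its parent. -/
structure Forest (V : Type*) where
  child : V → V → Prop
  rank : V → ℕ
  rank_child : ∀ {u v}, child u v → rank v = rank u + 1
  parent_unique : ∀ {u u' v}, child u v → child u' v → u = u'

namespace Forest

variable {V : Type*} (T : Forest V)

/-- The set of descendants of `v`, including `v`. -/
def desc (v : V) : Set V := {w | ReflTransGen T.child v w}

variable {T}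

lemma self_mem_desc (v : V) : v ∈ T.desc v := ReflTransGen.refl

lemma desc_subset_of_child {v c : V} (h : T.child v c) : T.desc c ⊆ T.desc v :=
  fun _ hw => ReflTransGen.head h hw

lemma mem_desc_iff {v w : V} : w ∈ T.desc v ↔ w = v ∨ ∃ c, T.child v c ∧ w ∈ T.desc c := by
  constructor
  · intro h
    rcases ReflTransGen.cases_head h with h | h
    · exact Or.inl h.symm
    · exact Or.inr h
  · rintro (rfl | ⟨c, hc, hw⟩)
    · exact self_mem_desc _
    · exact desc_subset_of_child hc hw

lemma rank_le_of_mem_desc {v w : V} (h : w ∈ T.desc v) : T.rank v ≤ T.rank w := by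
  induction h with
  | refl => exact le_rfl
  | tail _ h ih => rw [T.rank_child h]; omega

lemma not_mem_desc_child {v c : V} (h : T.child v c) : v ∉ T.desc c := fun hv => by
  have := rank_le_of_mem_desc hv
  rw [T.rank_child h] at this
  omega

lemma child_mem_desc {v u c : V} (hu : u ∈ T.desc v) (h : T.child u c) : c ∈ T.desc v :=
  ReflTransGen.tail hu h

/-- Unique parents make the path upwards from `w` unique, and ranks drop by one at each step, so it
meets each rank at most once. Disjointness of the subtrees of siblings follows. -/
lemma eq_of_mem_desc_of_rank_eq {v v' w : V} (h : w ∈ T.desc v) (h' : w ∈ T.desc v')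
    (hr : T.rank v = T.rank v') : v = v' := by
  induction h generalizing v' with
  | refl =>
    rcases ReflTransGen.cases_tail h' with h | ⟨b, hb, hbv⟩
    · exact h
    · have h1 := rank_le_of_mem_desc (T := T) hb
      have h2 := T.rank_child hbv
      omega
  | @tail b c hb hbc ih =>
    rcases ReflTransGen.cases_tail h' with h | ⟨b', hb', hbv⟩
    · subst h
      have h1 := rank_le_of_mem_desc (T := T) hb
      have h2 := T.rank_child hbc
      omega
    · have := T.parent_unique hbc hbv
      subst this
      exact ih hb' hr

lemma eq_of_mem_desc {v c c' w : V} (hc : T.child v c) (hc' : T.child v c')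
    (h : w ∈ T.desc c) (h' : w ∈ T.desc c') : c = c' :=
  eq_of_mem_desc_of_rank_eq h h' (by rw [T.rank_child hc, T.rank_child hc'])

variable [Fintype V]

open Classical in
/-- The children of `v`. -/
noncomputable def children (T : Forest V) (v : V) : Finset V := Finset.univ.filter (T.child v)

open Classical in
/-- The number of descendants of `v`. -/
noncomputable def size (T : Forest V) (v : V) : ℕ := (Finset.univ.filter (· ∈ T.desc v)).card

@[simp] lemma mem_children {v c : V} : c ∈ T.children v ↔ T.child v c := by simp [children]

lemma size_pos (v : V) : 0 < T.size v :=
  Finset.card_pos.2 ⟨v, by simp [self_mem_desc]⟩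

lemma size_eq (v : V) : T.size v = 1 + ∑ c ∈ T.children v, T.size c := by
  classical
  have h : Finset.univ.filter (· ∈ T.desc v) =
      insert v ((T.children v).biUnion fun c => Finset.univ.filter (· ∈ T.desc c)) := by
    ext w
    simp [mem_desc_iff (v := v)]
  unfold size
  rw [h, Finset.card_insert_of_notMem, Finset.card_biUnion, add_comm]
  · intro c hc c' hc' hne
    rw [Function.onFun, Finset.disjoint_left]
    intro w hw hw'
    simp only [Finset.mem_coe, mem_children, Finset.mem_filter, Finset.mem_univ,
      true_and] at hc hc' hw hw'
    exact hne (eq_of_mem_desc hc hc' hw hw')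
  · simp only [Finset.mem_biUnion, not_exists, mem_children, Finset.mem_filter, Finset.mem_univ,
      true_and, not_and]
    exact fun c hc => not_mem_desc_child hc

lemma size_lt_of_child {v c : V} (h : T.child v c) : T.size c < T.size v := by
  rw [size_eq v]
  have := Finset.single_le_sum (f := T.size) (fun _ _ => Nat.zero_le _) (mem_children.2 h)
  omega

/-- Induction from the leaves to the roots. -/
lemma leaf_induction (T : Forest V) {P : V → Prop}
    (h : ∀ v, (∀ c, T.child v c → P c) → P v) (v : V) : P v := by
  induction hn : T.size v using Nat.strong_induction_on generalizing v with
  | _ n ih =>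
    subst hn
    exact h v fun c hc => ih _ (size_lt_of_child hc) c rfl

end Forest

/-! ### Segments between grid points -/

lemma mem_seg {p q : ℤ × ℤ} {z : ℝ × ℝ} : z ∈ seg p q ↔ ∃ t : ℝ, 0 ≤ t ∧ t ≤ 1 ∧
    z.1 = p.1 + t * (q.1 - p.1) ∧ z.2 = p.2 + t * (q.2 - p.2) := by
  rw [seg, segment_eq_image']
  constructor
  · rintro ⟨t, ⟨h0, h1⟩, rfl⟩
    exact ⟨t, h0, h1, by simp [toPlane], by simp [toPlane]⟩
  · rintro ⟨t, h0, h1, hx, hy⟩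
    exact ⟨t, ⟨h0, h1⟩, Prod.ext (by simp [toPlane, hx]) (by simp [toPlane, hy])⟩

lemma left_mem_seg (p q : ℤ × ℤ) : toPlane p ∈ seg p q := left_mem_segment _ _ _

lemma seg_comm (p q : ℤ × ℤ) : seg p q = seg q p := segment_symm _ _ _

lemma toPlane_injective : Function.Injective toPlane := by
  rintro ⟨a, b⟩ ⟨c, d⟩ h
  simpa [toPlane] using h

/-! ### Drawings of subtrees -/

namespace Forest

variable {V : Type*} (T : Forest V)

/-- The union of all vertices and edges of the subtree rooted at `v`. -/
def body (pos : V → ℤ × ℤ) (v : V) : Set (ℝ × ℝ) :=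
  {z | ∃ u ∈ T.desc v, z = toPlane (pos u) ∨ ∃ c, T.child u c ∧ z ∈ seg (pos u) (pos c)}

/-- The edges from `u` to its children leave `u` in a planar way: they meet only in `u`, and the
edge to the child `c` meets the subtrees of the children only in `c`. -/
structure NodePlanar (pos : V → ℤ × ℤ) (u : V) : Prop where
  ne : ∀ c, T.child u c → pos u ≠ pos c
  seg_body : ∀ c, T.child u c → ∀ z ∈ seg (pos u) (pos c), z ∈ T.body pos c → z = toPlane (pos c)
  seg_seg : ∀ c c', T.child u c → T.child u c' → c ≠ c' →
    ∀ z ∈ seg (pos u) (pos c), z ∈ seg (pos u) (pos c') → z = toPlane (pos u)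
  seg_body' : ∀ c c', T.child u c → T.child u c' → c ≠ c' →
    ∀ z ∈ seg (pos u) (pos c), z ∉ T.body pos c'
  body_body : ∀ c c', T.child u c → T.child u c' → c ≠ c' →
    ∀ z ∈ T.body pos c, z ∉ T.body pos c'

/-- `pos` restricts to a planar drawing of the subtree rooted at `v`, with the second coordinate
weakly increasing from parents to children. -/
structure Draws (pos : V → ℤ × ℤ) (v : V) : Prop where
  planar : ∀ u ∈ T.desc v, T.NodePlanar pos u
  mono : ∀ u ∈ T.desc v, ∀ c, T.child u c → (pos u).2 ≤ (pos c).2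

variable {T}

lemma body_subset {pos : V → ℤ × ℤ} {v c : V} (h : T.child v c) :
    T.body pos c ⊆ T.body pos v := fun _ ⟨u, hu, hz⟩ => ⟨u, desc_subset_of_child h hu, hz⟩

lemma toPlane_mem_body {pos : V → ℤ × ℤ} {v w : V} (h : w ∈ T.desc v) :
    toPlane (pos w) ∈ T.body pos v := ⟨w, h, Or.inl rfl⟩

lemma seg_subset_body {pos : V → ℤ × ℤ} {v u c : V} (hu : u ∈ T.desc v) (h : T.child u c) :
    seg (pos u) (pos c) ⊆ T.body pos v := fun _ hz => ⟨u, hu, Or.inr ⟨c, h, hz⟩⟩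

lemma mem_body_iff {pos : V → ℤ × ℤ} {v : V} {z : ℝ × ℝ} : z ∈ T.body pos v ↔
    z = toPlane (pos v) ∨ ∃ c, T.child v c ∧ (z ∈ seg (pos v) (pos c) ∨ z ∈ T.body pos c) := by
  constructor
  · rintro ⟨u, hu, hz⟩
    rcases mem_desc_iff.1 hu with rfl | ⟨c, hc, hu⟩
    · rcases hz with hz | ⟨c, hc, hz⟩
      · exact Or.inl hz
      · exact Or.inr ⟨c, hc, Or.inl hz⟩
    · exact Or.inr ⟨c, hc, Or.inr ⟨u, hu, hz⟩⟩
  · rintro (rfl | ⟨c, hc, hz | hz⟩)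
    · exact toPlane_mem_body (self_mem_desc v)
    · exact seg_subset_body (self_mem_desc v) hc hz
    · exact body_subset hc hz

lemma body_subset_of_convex {pos : V → ℤ × ℤ} {v : V} {R : Set (ℝ × ℝ)} (hR : Convex ℝ R)
    (h : ∀ u ∈ T.desc v, toPlane (pos u) ∈ R) : T.body pos v ⊆ R := by
  rintro z ⟨u, hu, rfl | ⟨c, hc, hz⟩⟩
  · exact h u hu
  · exact hR.segment_subset (h u hu) (h c (child_mem_desc hu hc)) hz

lemma body_congr {pos pos' : V → ℤ × ℤ} {v : V} (h : ∀ u ∈ T.desc v, pos u = pos' u) :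
    T.body pos v = T.body pos' v := by
  have key : ∀ {pos pos' : V → ℤ × ℤ}, (∀ u ∈ T.desc v, pos u = pos' u) →
      T.body pos v ⊆ T.body pos' v := by
    rintro pos pos' h z ⟨u, hu, hz⟩
    refine ⟨u, hu, ?_⟩
    rw [h u hu] at hz
    refine hz.imp id ?_
    rintro ⟨c, hc, hz⟩
    exact ⟨c, hc, by rwa [← h c (child_mem_desc hu hc)]⟩
  exact (key h).antisymm (key fun u hu => (h u hu).symm)

lemma NodePlanar.congr {pos pos' : V → ℤ × ℤ} {v : V} (h : ∀ u ∈ T.desc v, pos u = pos' u)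
    (hp : T.NodePlanar pos v) : T.NodePlanar pos' v := by
  have hv := h v (self_mem_desc v)
  have hc : ∀ c, T.child v c → pos c = pos' c := fun c hc =>
    h c (child_mem_desc (self_mem_desc v) hc)
  have hb : ∀ c, T.child v c → T.body pos c = T.body pos' c := fun c hc =>
    body_congr fun u hu => h u (desc_subset_of_child hc hu)
  constructor
  · intro c h1
    rw [← hv, ← hc c h1]
    exact hp.ne c h1
  · intro c h1
    rw [← hv, ← hc c h1, ← hb c h1]
    exact hp.seg_body c h1
  · intro c c' h1 h2
    rw [← hv, ← hc c h1, ← hc c' h2]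
    exact hp.seg_seg c c' h1 h2
  · intro c c' h1 h2
    rw [← hv, ← hc c h1, ← hb c' h2]
    exact hp.seg_body' c c' h1 h2
  · intro c c' h1 h2
    rw [← hb c h1, ← hb c' h2]
    exact hp.body_body c c' h1 h2

lemma Draws.congr {pos pos' : V → ℤ × ℤ} {v : V} (h : ∀ u ∈ T.desc v, pos u = pos' u)
    (hd : T.Draws pos v) : T.Draws pos' v where
  planar u hu := (hd.planar u hu).congr fun w hw => h w (ReflTransGen.trans hu hw)
  mono u hu c hc := by
    rw [← h u hu, ← h c (child_mem_desc hu hc)]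
    exact hd.mono u hu c hc

/-! ### Affine images of drawings -/

/-- The map `(x, y) ↦ (x + a, e y + m x + b)` of the integer grid. -/
def aff (a b m e : ℤ) (p : ℤ × ℤ) : ℤ × ℤ := (p.1 + a, e * p.2 + m * p.1 + b)

/-- The map `(x, y) ↦ (x + a, e y + m x + b)` of the plane. -/
def affR (a b m e : ℤ) (z : ℝ × ℝ) : ℝ × ℝ := (z.1 + a, e * z.2 + m * z.1 + b)

lemma toPlane_aff (a b m e : ℤ) (p : ℤ × ℤ) :
    toPlane (aff a b m e p) = affR a b m e (toPlane p) := by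
  simp [toPlane, aff, affR]

lemma affR_injective {a b m e : ℤ} (he : e ≠ 0) : Function.Injective (affR a b m e) := by
  rintro ⟨x, y⟩ ⟨x', y'⟩ h
  simp only [affR, Prod.mk.injEq, add_left_inj] at h
  obtain ⟨rfl, h⟩ := h
  have : (e : ℝ) ≠ 0 := by exact_mod_cast he
  simpa [this] using h

lemma seg_aff (a b m e : ℤ) (p q : ℤ × ℤ) :
    seg (aff a b m e p) (aff a b m e q) = affR a b m e '' seg p q := by
  ext z
  simp only [Set.mem_image, mem_seg]
  constructor
  · rintro ⟨t, h0, h1, hx, hy⟩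
    refine ⟨(p.1 + t * (q.1 - p.1), p.2 + t * (q.2 - p.2)), ⟨t, h0, h1, rfl, rfl⟩, ?_⟩
    ext
    · simp only [affR, hx, aff]; push_cast; ring
    · simp only [affR, hy, aff]; push_cast; ring
  · rintro ⟨w, ⟨t, h0, h1, hx, hy⟩, rfl⟩
    refine ⟨t, h0, h1, ?_, ?_⟩
    · simp only [affR, hx, aff]; push_cast; ring
    · simp only [affR, hx, hy, aff]; push_cast; ring

lemma body_aff (a b m e : ℤ) (pos : V → ℤ × ℤ) (v : V) :
    T.body (fun w => aff a b m e (pos w)) v = affR a b m e '' T.body pos v := by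
  ext z
  constructor
  · rintro ⟨u, hu, hz | ⟨c, hc, hz⟩⟩
    · exact ⟨_, toPlane_mem_body hu, by rw [hz, toPlane_aff]⟩
    · rw [seg_aff] at hz
      exact Set.image_mono (seg_subset_body hu hc) hz
  · rintro ⟨w, ⟨u, hu, rfl | ⟨c, hc, hz⟩⟩, rfl⟩
    · exact ⟨u, hu, Or.inl (toPlane_aff _ _ _ _ _).symm⟩
    · exact ⟨u, hu, Or.inr ⟨c, hc, by rw [seg_aff]; exact ⟨w, hz, rfl⟩⟩⟩

lemma NodePlanar.aff {a b m e : ℤ} (he : e ≠ 0) {pos : V → ℤ × ℤ} {v : V}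
    (h : T.NodePlanar pos v) : T.NodePlanar (fun w => aff a b m e (pos w)) v := by
  have inj := affR_injective (a := a) (b := b) (m := m) he
  constructor
  · intro c hc h'
    refine h.ne c hc (toPlane_injective (inj ?_))
    rw [← toPlane_aff, ← toPlane_aff, h']
  · intro c hc
    rw [seg_aff, body_aff]
    rintro _ ⟨z, hz, rfl⟩ ⟨z', hz', hzz⟩
    rw [inj hzz] at hz'
    rw [toPlane_aff, h.seg_body c hc z hz hz']
  · intro c c' hc hc' hne
    rw [seg_aff, seg_aff]
    rintro _ ⟨z, hz, rfl⟩ ⟨z', hz', hzz⟩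
    rw [inj hzz] at hz'
    rw [toPlane_aff, h.seg_seg c c' hc hc' hne z hz hz']
  · intro c c' hc hc' hne
    rw [seg_aff, body_aff]
    rintro _ ⟨z, hz, rfl⟩ ⟨z', hz', hzz⟩
    rw [inj hzz] at hz'
    exact h.seg_body' c c' hc hc' hne z hz hz'
  · intro c c' hc hc' hne
    rw [body_aff, body_aff]
    rintro _ ⟨z, hz, rfl⟩ ⟨z', hz', hzz⟩
    rw [inj hzz] at hz'
    exact h.body_body c c' hc hc' hne z hz hz'

lemma Draws.shift {a b : ℤ} {pos : V → ℤ × ℤ} {v : V} (h : T.Draws pos v) :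
    T.Draws (fun w => aff a b 0 1 (pos w)) v where
  planar u hu := (h.planar u hu).aff one_ne_zero
  mono u hu c hc := by simpa [Forest.aff] using h.mono u hu c hc

/-- A downward vertical shear adds `m` times the horizontal displacement to every edge, so it
preserves the order of the second coordinates only when edges also go weakly to the right; this is
the purpose of `MonoX`. -/
lemma Draws.shear {a b m : ℤ} (hm : 0 ≤ m) {pos : V → ℤ × ℤ} {v : V} (h : T.Draws pos v)
    (hx : ∀ u ∈ T.desc v, ∀ c, T.child u c → (pos u).1 ≤ (pos c).1) :
    T.Draws (fun w => aff a b m 1 (pos w)) v where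
  planar u hu := (h.planar u hu).aff one_ne_zero
  mono u hu c hc := by
    have h1 := h.mono u hu c hc
    have h2 := mul_le_mul_of_nonneg_left (hx u hu c hc) hm
    simp only [Forest.aff, one_mul]
    omega

/-! ### Combining drawings of the children -/

open Classical in
/-- Draw `v` at `p` and the subtree of every child `c` of `v` as in `Pos c`. -/
noncomputable def glue (T : Forest V) (v : V) (p : ℤ × ℤ) (Pos : V → V → ℤ × ℤ) (w : V) : ℤ × ℤ :=
  if w = v then p else
    if h : ∃ c, T.child v c ∧ w ∈ T.desc c then Pos h.choose w else 0

lemma glue_self (v : V) (p : ℤ × ℤ) (Pos : V → V → ℤ × ℤ) : glue T v p Pos v = p := by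
  simp [glue]

lemma glue_of_mem {v c w : V} (p : ℤ × ℤ) (Pos : V → V → ℤ × ℤ) (hc : T.child v c)
    (hw : w ∈ T.desc c) : glue T v p Pos w = Pos c w := by
  have hne : w ≠ v := fun h => not_mem_desc_child hc (h ▸ hw)
  have hex : ∃ c, T.child v c ∧ w ∈ T.desc c := ⟨c, hc, hw⟩
  rw [glue, if_neg hne, dif_pos hex, eq_of_mem_desc hex.choose_spec.1 hc hex.choose_spec.2 hw]

/-- Every condition of `NodePlanar` passes to subsets of the bodies, so it suffices to check it for
simple regions `R c` enclosing them, such as rectangles or parallelograms. Inside a child's subtree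
nothing changes. -/
lemma exists_glue {v : V} {p : ℤ × ℤ} {Pos : V → V → ℤ × ℤ} {R : V → Set (ℝ × ℝ)}
    (hd : ∀ c, T.child v c → T.Draws (Pos c) c)
    (hR : ∀ c, T.child v c → T.body (Pos c) c ⊆ R c)
    (hp : ∀ c, T.child v c → p.2 ≤ (Pos c c).2)
    (hne : ∀ c, T.child v c → p ≠ Pos c c)
    (h1 : ∀ c, T.child v c → ∀ z ∈ seg p (Pos c c), z ∈ R c → z = toPlane (Pos c c))
    (h2 : ∀ c c', T.child v c → T.child v c' → c ≠ c' →
      ∀ z ∈ seg p (Pos c c), z ∈ seg p (Pos c' c') → z = toPlane p)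
    (h3 : ∀ c c', T.child v c → T.child v c' → c ≠ c' → ∀ z ∈ seg p (Pos c c), z ∉ R c')
    (h4 : ∀ c c', T.child v c → T.child v c' → c ≠ c' → ∀ z ∈ R c, z ∉ R c') :
    ∃ pos : V → ℤ × ℤ, T.Draws pos v ∧ pos v = p ∧
      (∀ c, T.child v c → ∀ w ∈ T.desc c, pos w = Pos c w) ∧
      ∀ z ∈ T.body pos v, z = toPlane p ∨ ∃ c, T.child v c ∧ (z ∈ seg p (Pos c c) ∨ z ∈ R c) := by
  have hv : glue T v p Pos v = p := glue_self v p Pos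
  have hw : ∀ c, T.child v c → ∀ w ∈ T.desc c, glue T v p Pos w = Pos c w :=
    fun c hc w hw => glue_of_mem p Pos hc hw
  have hs : ∀ c, T.child v c → glue T v p Pos c = Pos c c := fun c hc => hw c hc c (self_mem_desc c)
  have hb : ∀ c, T.child v c → T.body (glue T v p Pos) c ⊆ R c := fun c hc => by
    rw [body_congr (hw c hc)]
    exact hR c hc
  refine ⟨glue T v p Pos, ⟨?_, ?_⟩, hv, hw, ?_⟩
  · intro u hu
    rcases mem_desc_iff.1 hu with rfl | ⟨c, hc, hu⟩
    · constructor
      · intro c hc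
        rw [hv, hs c hc]
        exact hne c hc
      · intro c hc
        rw [hv, hs c hc]
        exact fun z hz hz' => h1 c hc z hz (hb c hc hz')
      · intro c c' hc hc' hn
        rw [hv, hs c hc, hs c' hc']
        exact h2 c c' hc hc' hn
      · intro c c' hc hc' hn
        rw [hv, hs c hc]
        exact fun z hz hz' => h3 c c' hc hc' hn z hz (hb c' hc' hz')
      · intro c c' hc hc' hn z hz hz'
        exact h4 c c' hc hc' hn z (hb c hc hz) (hb c' hc' hz')
    · exact ((hd c hc).congr fun w hw' => (hw c hc w hw').symm).planar u hu
  · intro u hu d hud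
    rcases mem_desc_iff.1 hu with rfl | ⟨c, hc, hu⟩
    · rw [hv, hs d hud]
      exact hp d hud
    · exact ((hd c hc).congr fun w hw' => (hw c hc w hw').symm).mono u hu d hud
  · intro z hz
    rcases mem_body_iff.1 hz with hz | ⟨c, hc, hz⟩
    · rw [hv] at hz
      exact Or.inl hz
    · rw [hv, hs c hc] at hz
      exact Or.inr ⟨c, hc, hz.imp id fun h => hb c hc h⟩

/-! ### From local to global planarity -/

lemma injOn_of_planar [Fintype V] {pos : V → ℤ × ℤ} (v : V)
    (h : ∀ u ∈ T.desc v, T.NodePlanar pos u) :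
    Set.InjOn pos (T.desc v) := by
  induction v using T.leaf_induction with
  | h v ih =>
    have hv := h v (self_mem_desc v)
    have hnot : ∀ c, T.child v c → toPlane (pos v) ∉ T.body pos c := fun c hc hm =>
      hv.ne c hc (toPlane_injective (hv.seg_body c hc _ (left_mem_seg _ _) hm))
    intro w hw w' hw' heq
    rcases mem_desc_iff.1 hw with rfl | ⟨c, hc, hwc⟩ <;>
      rcases mem_desc_iff.1 hw' with rfl | ⟨c', hc', hwc'⟩
    · rfl
    · exact (hnot c' hc' (heq ▸ toPlane_mem_body hwc')).elim
    · exact (hnot c hc (heq ▸ toPlane_mem_body hwc)).elim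
    · by_cases hcc : c = c'
      · subst hcc
        exact ih c hc (fun u hu => h u (desc_subset_of_child hc hu)) hwc hwc' heq
      · exact (hv.body_body c c' hc hc' hcc _ (toPlane_mem_body hwc)
          (heq ▸ toPlane_mem_body hwc')).elim

lemma vertex_on_edge_of_planar [Fintype V] {pos : V → ℤ × ℤ} (v : V)
    (h : ∀ u ∈ T.desc v, T.NodePlanar pos u) {a b w : V} (ha : a ∈ T.desc v) (hab : T.child a b)
    (hw : w ∈ T.desc v) (hm : toPlane (pos w) ∈ seg (pos a) (pos b)) : w = a ∨ w = b := by
  induction v using T.leaf_induction with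
  | h v ih =>
    have hv := h v (self_mem_desc v)
    have hinj := injOn_of_planar v h
    have hnot : ∀ c, T.child v c → toPlane (pos v) ∉ T.body pos c := fun c hc hm =>
      hv.ne c hc (toPlane_injective (hv.seg_body c hc _ (left_mem_seg _ _) hm))
    rcases mem_desc_iff.1 ha with rfl | ⟨c, hc, hac⟩
    · rcases mem_desc_iff.1 hw with rfl | ⟨c', hc', hw'⟩
      · exact Or.inl rfl
      · by_cases hcc : b = c'
        · subst hcc
          have := hv.seg_body b hab _ hm (toPlane_mem_body hw')
          exact Or.inr (hinj hw (child_mem_desc ha hab) (toPlane_injective this))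
        · exact (hv.seg_body' b c' hab hc' hcc _ hm (toPlane_mem_body hw')).elim
    · rcases mem_desc_iff.1 hw with rfl | ⟨c', hc', hw'⟩
      · exact (hnot c hc (seg_subset_body hac hab hm)).elim
      · by_cases hcc : c = c'
        · subst hcc
          exact ih c hc (fun u hu => h u (desc_subset_of_child hc hu)) hac hw'
        · exact (hv.body_body c c' hc hc' hcc _ (seg_subset_body hac hab hm)
            (toPlane_mem_body hw')).elim

/-- Two edges in one child subtree are settled by induction. Otherwise they are separated at `v`:
either they lie in disjoint bodies, or one of them starts at `v` and `NodePlanar` leaves only its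
end as a meeting point. -/
lemma edge_inter_of_planar [Fintype V] {pos : V → ℤ × ℤ} (v : V)
    (h : ∀ u ∈ T.desc v, T.NodePlanar pos u) {a b c d : V} (ha : a ∈ T.desc v) (hab : T.child a b)
    (hc : c ∈ T.desc v) (hcd : T.child c d) (hne : b ≠ d) {z : ℝ × ℝ}
    (hz : z ∈ seg (pos a) (pos b)) (hz' : z ∈ seg (pos c) (pos d)) :
    ∃ w, (w = a ∨ w = b) ∧ (w = c ∨ w = d) ∧ z = toPlane (pos w) := by
  induction v using T.leaf_induction with
  | h v ih =>
    have hv := h v (self_mem_desc v)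
    have key : ∀ {b c d : V}, T.child v b → (∃ e, T.child v e ∧ c ∈ T.desc e) → T.child c d →
        z ∈ seg (pos v) (pos b) → z ∈ seg (pos c) (pos d) →
        ∃ w, (w = v ∨ w = b) ∧ (w = c ∨ w = d) ∧ z = toPlane (pos w) := by
      rintro b c d hb ⟨e, he, hc⟩ hcd hz hz'
      by_cases hbe : b = e
      · subst hbe
        have := hv.seg_body b hb z hz (seg_subset_body hc hcd hz')
        subst this
        exact ⟨b, Or.inr rfl, vertex_on_edge_of_planar v h (desc_subset_of_child hb hc) hcd
          (child_mem_desc (self_mem_desc v) hb) hz', rfl⟩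
      · exact (hv.seg_body' b e hb he hbe z hz (seg_subset_body hc hcd hz')).elim
    rcases mem_desc_iff.1 ha with rfl | ha' <;> rcases mem_desc_iff.1 hc with rfl | hc'
    · exact ⟨c, Or.inl rfl, Or.inl rfl, hv.seg_seg b d hab hcd hne z hz hz'⟩
    · exact key hab hc' hcd hz hz'
    · obtain ⟨w, hw1, hw2, hw3⟩ := key hcd ha' hab hz' hz
      exact ⟨w, hw2, hw1, hw3⟩
    · obtain ⟨e, he, ha'⟩ := ha'
      obtain ⟨e', he', hc'⟩ := hc'
      by_cases hee : e = e'
      · subst hee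
        exact ih e he (fun u hu => h u (desc_subset_of_child he hu)) ha' hc'
      · exact (hv.body_body e e' he he' hee z (seg_subset_body ha' hab hz)
          (seg_subset_body hc' hcd hz')).elim

end Forest

end TreeDrawing

/-! ### Packing subtrees in a row -/

namespace TreeDrawing

open Relation

/-- The hypothesis says that the two direction vectors have nonzero determinant, so the lines
through `p` are distinct. -/
lemma eq_left_of_mem_seg_of_mem_seg {p q q' : ℤ × ℤ}
    (h : (q.1 - p.1) * (q'.2 - p.2) ≠ (q'.1 - p.1) * (q.2 - p.2)) {z : ℝ × ℝ}
    (hz : z ∈ seg p q) (hz' : z ∈ seg p q') : z = toPlane p := by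
  obtain ⟨t, -, -, hx, hy⟩ := mem_seg.1 hz
  obtain ⟨t', -, -, hx', hy'⟩ := mem_seg.1 hz'
  have h' : ((q.1 - p.1) * (q'.2 - p.2) : ℝ) ≠ (q'.1 - p.1) * (q.2 - p.2) := by exact_mod_cast h
  have hx2 : t * (q.1 - p.1 : ℝ) = t' * (q'.1 - p.1) := by linarith
  have hy2 : t * (q.2 - p.2 : ℝ) = t' * (q'.2 - p.2) := by linarith
  have ht : t = 0 := by
    have : t * ((q.1 - p.1) * (q'.2 - p.2) - (q'.1 - p.1) * (q.2 - p.2) : ℝ) = 0 := by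
      linear_combination ((q'.2 : ℝ) - p.2) * hx2 - ((q'.1 : ℝ) - p.1) * hy2
    exact (mul_eq_zero.1 this).resolve_right (sub_ne_zero.2 h')
  subst ht
  ext
  · simp [hx, toPlane]
  · simp [hy, toPlane]

/-- Disjoint intervals of prescribed lengths can be packed without gaps. -/
lemma exists_packing {V : Type*} (S : Finset V) (f : V → ℕ) :
    ∃ X : V → ℕ, (∀ c ∈ S, X c + f c ≤ ∑ c ∈ S, f c) ∧
      ∀ c ∈ S, ∀ c' ∈ S, c ≠ c' → X c + f c ≤ X c' ∨ X c' + f c' ≤ X c := by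
  classical
  induction S using Finset.induction_on with
  | empty => exact ⟨fun _ => 0, by simp, by simp⟩
  | insert a S ha ih =>
    obtain ⟨X, h1, h2⟩ := ih
    refine ⟨Function.update X a (∑ c ∈ S, f c), ?_, ?_⟩
    · intro c hc
      rw [Finset.sum_insert ha]
      rcases Finset.mem_insert.1 hc with rfl | hcS
      · rw [Function.update_self]; omega
      · rw [Function.update_of_ne (ne_of_mem_of_not_mem hcS ha)]
        have := h1 c hcS
        omega
    · intro c hc c' hc' hne
      rcases Finset.mem_insert.1 hc with rfl | hcS <;>
        rcases Finset.mem_insert.1 hc' with rfl | hcS'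
      · exact (hne rfl).elim
      · rw [Function.update_self, Function.update_of_ne (Ne.symm hne)]
        exact Or.inr (h1 c' hcS')
      · rw [Function.update_self, Function.update_of_ne hne]
        exact Or.inl (h1 c hcS)
      · rw [Function.update_of_ne (ne_of_mem_of_not_mem hcS ha),
          Function.update_of_ne (ne_of_mem_of_not_mem hcS' ha)]
        exact h2 c hcS c' hcS' hne

/-- The axis-parallel closed rectangle `[a, b] × [c, d]`. -/
def rect (a b c d : ℝ) : Set (ℝ × ℝ) := {z | a ≤ z.1 ∧ z.1 ≤ b ∧ c ≤ z.2 ∧ z.2 ≤ d}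

lemma convex_rect (a b c d : ℝ) : Convex ℝ (rect a b c d) := by
  have : rect a b c d = Set.Icc a b ×ˢ Set.Icc c d := by
    ext z
    simp only [rect, Set.mem_ofPred_eq, Set.mem_prod, Set.mem_Icc]
    tauto
  rw [this]
  exact (convex_Icc a b).prod (convex_Icc c d)

namespace Forest

variable {V : Type*} {T : Forest V}

/-- A drawing of the subtree rooted at `v` in `w` columns and `h` rows with `v` in the corner. -/
structure BoxDraws (T : Forest V) (pos : V → ℤ × ℤ) (v : V) (w h : ℕ) : Prop where
  draws : T.Draws pos v
  root : pos v = 0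
  bound : ∀ u ∈ T.desc v, 0 ≤ (pos u).1 ∧ (pos u).1 < w ∧ 0 ≤ (pos u).2 ∧ (pos u).2 < h

lemma BoxDraws.mono {pos : V → ℤ × ℤ} {v : V} {w h w' h' : ℕ} (hb : T.BoxDraws pos v w h)
    (hw : w ≤ w') (hh : h ≤ h') : T.BoxDraws pos v w' h' :=
  ⟨hb.draws, hb.root, fun u hu => by have := hb.bound u hu; omega⟩

/-- The first coordinate weakly increases from parents to children. -/
def MonoX (T : Forest V) (pos : V → ℤ × ℤ) (v : V) : Prop :=
  ∀ u ∈ T.desc v, ∀ c, T.child u c → (pos u).1 ≤ (pos c).1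

/-- The drawing of `c` shifted by `(a, b)` lies in the rectangle shifted by `(a, b)`. -/
lemma BoxDraws.body_shift_subset {pos : V → ℤ × ℤ} {c : V} {w h : ℕ} (hb : T.BoxDraws pos c w h)
    (a b : ℤ) : T.body (fun w => aff a b 0 1 (pos w)) c ⊆
      rect a (a + w - 1) b (b + h - 1) := by
  refine body_subset_of_convex (convex_rect _ _ _ _) fun u hu => ?_
  obtain ⟨h1, h2, h3, h4⟩ := hb.bound u hu
  have h2' : (pos u).1 ≤ w - 1 := by omega
  have h4' : (pos u).2 ≤ h - 1 := by omega
  have e1 : (0 : ℝ) ≤ (pos u).1 := by exact_mod_cast h1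
  have e2 : ((pos u).1 : ℝ) ≤ w - 1 := by exact_mod_cast h2'
  have e3 : (0 : ℝ) ≤ (pos u).2 := by exact_mod_cast h3
  have e4 : ((pos u).2 : ℝ) ≤ h - 1 := by exact_mod_cast h4'
  simp only [rect, toPlane, aff, Set.mem_ofPred_eq]
  push_cast
  exact ⟨by linarith, by linarith, by linarith, by linarith⟩

variable [Fintype V]

open Classical in
/-- Draw all children of `v` but one in a row below `v`. -/
lemma exists_row {v u : V} (hu : T.child v u) {p : ℤ × ℤ} {X₀ : ℤ} {h S : ℕ}
    {posu : V → ℤ × ℤ} {R : Set (ℝ × ℝ)} {Pl : V → V → ℤ × ℤ}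
    (hdu : T.Draws posu u) (hbu : T.body posu u ⊆ R) (hpu : p.2 ≤ (posu u).2) (hne : p ≠ posu u)
    (hS : S = ∑ c ∈ (T.children v).erase u, T.size c)
    (hl : ∀ c, T.child v c → c ≠ u → T.BoxDraws (Pl c) c (T.size c) h)
    (h1 : ∀ z ∈ seg p (posu u), z ∈ R → z = toPlane (posu u))
    (hray : ∀ X : ℤ, X₀ ≤ X → X < X₀ + S → ∀ z ∈ seg p (X, p.2 + 1), z ∉ R ∧
      (z ∈ seg p (posu u) → z = toPlane p))
    (hbox : ∀ z ∈ rect X₀ (X₀ + S - 1) (p.2 + 1) (p.2 + h), z ∉ R ∧ z ∉ seg p (posu u)) :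
    ∃ pos : V → ℤ × ℤ, T.Draws pos v ∧ pos v = p ∧ (∀ w ∈ T.desc u, pos w = posu w) ∧
      (∀ c, T.child v c → c ≠ u → ∃ X : ℤ, X₀ ≤ X ∧ X + T.size c ≤ X₀ + S ∧
        ∀ w ∈ T.desc c, pos w = aff X (p.2 + 1) 0 1 (Pl c w)) ∧
      ∀ z ∈ T.body pos v, z = toPlane p ∨ z ∈ seg p (posu u) ∨ z ∈ R ∨
        (∃ X : ℤ, X₀ ≤ X ∧ X < X₀ + S ∧ z ∈ seg p (X, p.2 + 1)) ∨
        z ∈ rect X₀ (X₀ + S - 1) (p.2 + 1) (p.2 + h) := by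
  obtain ⟨X, hX1, hX2⟩ := exists_packing ((T.children v).erase u) T.size
  rw [← hS] at hX1
  have hmem : ∀ {c}, T.child v c → c ≠ u → c ∈ (T.children v).erase u := fun hc hcu =>
    Finset.mem_erase.2 ⟨hcu, mem_children.2 hc⟩
  -- The child `u` keeps a drawing and a region supplied from outside; only the other children are
  -- packed. Their roots lie exactly one row below `p`, so edges to them reach the packed boxes only
  -- at their ends.
  let Pos : V → V → ℤ × ℤ := fun c => if c = u then posu else
    fun w => aff (X₀ + X c) (p.2 + 1) 0 1 (Pl c w)
  let Q : V → Set (ℝ × ℝ) := fun c => if c = u then R else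
    rect (X₀ + X c) (X₀ + X c + T.size c - 1) (p.2 + 1) (p.2 + h)
  have Pu : Pos u = posu := by simp [Pos]
  have Pc : ∀ {c}, c ≠ u → Pos c = fun w => aff (X₀ + X c) (p.2 + 1) 0 1 (Pl c w) := fun h => by
    simp [Pos, h]
  have Qu : Q u = R := by simp [Q]
  have Qc : ∀ {c}, c ≠ u → Q c =
      rect (X₀ + X c) (X₀ + X c + T.size c - 1) (p.2 + 1) (p.2 + h) := fun h => by
    simp [Q, h]
  have Pcc : ∀ {c}, T.child v c → c ≠ u → Pos c c = (X₀ + X c, p.2 + 1) := fun hc hcu => by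
    simp [Pc hcu, (hl _ hc hcu).root, aff]
  have Xlt : ∀ {c}, T.child v c → c ≠ u → (X₀ + X c : ℤ) < X₀ + S := fun {c} hc hcu => by
    have := hX1 c (hmem hc hcu)
    have := T.size_pos c
    omega
  have Qsub : ∀ {c}, T.child v c → c ≠ u → Q c ⊆ rect X₀ (X₀ + S - 1) (p.2 + 1) (p.2 + h) := by
    rintro c hc hcu z hz
    rw [Qc hcu] at hz
    obtain ⟨z1, z2, z3, z4⟩ := hz
    have e : (X c + T.size c : ℝ) ≤ S := by exact_mod_cast hX1 c (hmem hc hcu)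
    have e' : (0 : ℝ) ≤ X c := Nat.cast_nonneg _
    exact ⟨by linarith, by linarith, z3, z4⟩
  have Rseg : ∀ {c}, T.child v c → c ≠ u → ∀ z ∈ seg p (Pos c c), z ∉ R ∧
      (z ∈ seg p (posu u) → z = toPlane p) := fun {c} hc hcu => by
    rw [Pcc hc hcu]
    exact hray _ (by omega) (Xlt hc hcu)
  have Rbox : ∀ {c}, T.child v c → c ≠ u → ∀ z ∈ Q c, z ∉ R ∧ z ∉ seg p (posu u) :=
    fun hc hcu z hz => hbox z (Qsub hc hcu hz)
  -- a point of the edge to `c` on or below the first row is the end of the edge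
  have low : ∀ {c}, T.child v c → c ≠ u → ∀ z ∈ seg p (Pos c c), (p.2 + 1 : ℝ) ≤ z.2 →
      z = toPlane (Pos c c) := fun {c} hc hcu z hz hz2 => by
    rw [Pcc hc hcu] at hz ⊢
    obtain ⟨t, t0, t1, hx, hy⟩ := mem_seg.1 hz
    push_cast at hx hy
    have : t = 1 := by linarith
    subst this
    ext
    · simp [hx, toPlane]
    · simp [hy, toPlane]
  have sep : ∀ {c c'}, T.child v c → T.child v c' → c ≠ u → c' ≠ u → c ≠ c' →
      X c + T.size c ≤ X c' ∨ X c' + T.size c' ≤ X c := fun hc hc' hcu hcu' hcc =>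
    hX2 _ (hmem hc hcu) _ (hmem hc' hcu') hcc
  have sepQ : ∀ {c c'}, T.child v c → T.child v c' → c ≠ u → c' ≠ u → c ≠ c' →
      ∀ z ∈ Q c, z ∉ Q c' := fun {c c'} hc hc' hcu hcu' hcc z hz hz' => by
    rw [Qc hcu] at hz
    rw [Qc hcu'] at hz'
    obtain ⟨z1, z2, -, -⟩ := hz
    obtain ⟨z1', z2', -, -⟩ := hz'
    rcases sep hc hc' hcu hcu' hcc with h | h
    · have : (X c + T.size c : ℝ) ≤ X c' := by exact_mod_cast h
      linarith
    · have : (X c' + T.size c' : ℝ) ≤ X c := by exact_mod_cast h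
      linarith
  have bodyQ : ∀ {c}, T.child v c → c ≠ u → T.body (Pos c) c ⊆ Q c := fun {c} hc hcu => by
    rw [Pc hcu, Qc hcu]
    refine ((hl c hc hcu).body_shift_subset _ _).trans ?_
    rintro z ⟨z1, z2, z3, z4⟩
    push_cast at z1 z2 z3 z4
    exact ⟨z1, z2, z3, by linarith⟩
  have rootQ : ∀ {c}, T.child v c → c ≠ u → toPlane (Pos c c) ∈ Q c := fun {c} hc hcu =>
    bodyQ hc hcu (toPlane_mem_body (self_mem_desc c))
  refine (exists_glue (T := T) (v := v) (p := p) (Pos := Pos) (R := Q)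
    ?_ ?_ ?_ ?_ ?_ ?_ ?_ ?_).elim fun pos ⟨g1, g2, g3, g4⟩ => ?_
  · intro c hc
    by_cases hcu : c = u
    · subst hcu; rwa [Pu]
    · rw [Pc hcu]
      exact (hl c hc hcu).draws.shift
  · intro c hc
    by_cases hcu : c = u
    · subst hcu; rwa [Pu, Qu]
    · exact bodyQ hc hcu
  · intro c hc
    by_cases hcu : c = u
    · subst hcu; rwa [Pu]
    · rw [Pcc hc hcu]; simp
  · intro c hc
    by_cases hcu : c = u
    · subst hcu; rwa [Pu]
    · rw [Pcc hc hcu]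
      intro h
      have := congrArg Prod.snd h
      simp at this
  · intro c hc
    by_cases hcu : c = u
    · subst hcu; rwa [Pu, Qu]
    · intro z hz hz'
      refine low hc hcu z hz ?_
      rw [Qc hcu] at hz'
      exact hz'.2.2.1
  · intro c c' hc hc' hcc z hz hz'
    by_cases hcu : c = u
    · subst hcu
      rw [Pu] at hz
      exact (Rseg hc' (Ne.symm hcc) z hz').2 hz
    · by_cases hcu' : c' = u
      · subst hcu'
        rw [Pu] at hz'
        exact (Rseg hc hcu z hz).2 hz'
      · refine eq_left_of_mem_seg_of_mem_seg ?_ hz hz'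
        rw [Pcc hc hcu, Pcc hc' hcu']
        have := T.size_pos c
        have := T.size_pos c'
        have := sep hc hc' hcu hcu' hcc
        simp only [add_sub_cancel_left, mul_one]
        omega
  · intro c c' hc hc' hcc z hz hz'
    by_cases hcu : c = u
    · subst hcu
      rw [Pu] at hz
      exact (Rbox hc' (Ne.symm hcc) z hz').2 hz
    · by_cases hcu' : c' = u
      · subst hcu'
        rw [Qu] at hz'
        exact (Rseg hc hcu z hz).1 hz'
      · have e := low hc hcu z hz (by rw [Qc hcu'] at hz'; exact hz'.2.2.1)
        subst e
        exact sepQ hc hc' hcu hcu' hcc _ (rootQ hc hcu) hz'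
  · intro c c' hc hc' hcc z hz hz'
    by_cases hcu : c = u
    · subst hcu
      rw [Qu] at hz
      exact (Rbox hc' (Ne.symm hcc) z hz').1 hz
    · by_cases hcu' : c' = u
      · subst hcu'
        rw [Qu] at hz'
        exact (Rbox hc hcu z hz).1 hz'
      · exact sepQ hc hc' hcu hcu' hcc z hz hz'
  · refine ⟨pos, g1, g2, ?_, ?_, ?_⟩
    · intro w hw
      rw [g3 u hu w hw, Pu]
    · intro c hc hcu
      refine ⟨X₀ + X c, by omega, by have := hX1 c (hmem hc hcu); omega, fun w hw => ?_⟩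
      rw [g3 c hc w hw, Pc hcu]
    · intro z hz
      rcases g4 z hz with h | ⟨c, hc, h⟩
      · exact Or.inl h
      · by_cases hcu : c = u
        · subst hcu
          rw [Pu, Qu] at h
          tauto
        · rcases h with h | h
          · rw [Pcc hc hcu] at h
            exact Or.inr (Or.inr (Or.inr (Or.inl ⟨_, by omega, Xlt hc hcu, h⟩)))
          · exact Or.inr (Or.inr (Or.inr (Or.inr (Qsub hc hcu h))))

end Forest

end TreeDrawing

/-! ### Horizontal drawings with logarithmically many rows -/

namespace TreeDrawing

open Relation

namespace Forest

variable {V : Type*} {T : Forest V}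

lemma desc_eq_singleton {v : V} (h : ∀ c, ¬ T.child v c) {w : V} (hw : w ∈ T.desc v) : w = v := by
  rcases mem_desc_iff.1 hw with h' | ⟨c, hc, -⟩
  · exact h'
  · exact (h c hc).elim

lemma draws_of_leaf {v : V} (h : ∀ c, ¬ T.child v c) (pos : V → ℤ × ℤ) : T.Draws pos v where
  planar u hu := by
    rw [desc_eq_singleton h hu]
    exact ⟨fun c hc => (h c hc).elim, fun c hc => (h c hc).elim, fun c _ hc => (h c hc).elim,
      fun c _ hc => (h c hc).elim, fun c _ hc => (h c hc).elim⟩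
  mono u hu c hc := (h c (desc_eq_singleton h hu ▸ hc)).elim

variable [Fintype V]

lemma corner_bound {w h : ℕ} (hw : 0 < w) (hh : 0 < h) : 0 ≤ (0 : ℤ × ℤ).1 ∧
    (0 : ℤ × ℤ).1 < w ∧ 0 ≤ (0 : ℤ × ℤ).2 ∧ (0 : ℤ × ℤ).2 < h := by
  simp only [Prod.fst_zero, Prod.snd_zero]
  omega

lemma sum_erase_size {v u : V} [DecidableEq V] (hu : T.child v u) :
    1 + T.size u + ∑ c ∈ (T.children v).erase u, T.size c = T.size v := by
  rw [size_eq v, ← Finset.add_sum_erase _ _ (mem_children.2 hu), add_assoc]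

/-- A child that is not the heaviest has less than half of the nodes of its parent. This pays for
the extra row in horizontal drawings and for the extra column in stacked ones. -/
lemma log_size_lt {v u c : V} (hu : T.child v u) (hc : T.child v c) (hcu : c ≠ u)
    (hle : T.size c ≤ T.size u) : Nat.log 2 (T.size c) + 1 ≤ Nat.log 2 (T.size v) := by
  classical
  have h1 := sum_erase_size hu
  have h2 := Finset.single_le_sum (f := T.size) (fun _ _ => Nat.zero_le _)
    (Finset.mem_erase.2 ⟨hcu, mem_children.2 hc⟩)
  have h3 := T.size_pos c
  rw [← Nat.log_mul_base one_lt_two h3.ne']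
  exact Nat.log_mono_right (by omega)

/-- Every tree with `n` nodes can be drawn in `n` columns and `log₂ n + 1` rows. -/
lemma exists_horizontal (T : Forest V) (v : V) : ∃ pos : V → ℤ × ℤ,
    T.BoxDraws pos v (T.size v) (Nat.log 2 (T.size v) + 1) ∧ T.MonoX pos v := by
  classical
  induction v using T.leaf_induction with
  | h v ih =>
  by_cases hleaf : ∃ c, T.child v c
  swap
  · push Not at hleaf
    refine ⟨fun _ => 0, ⟨draws_of_leaf hleaf _, rfl, fun u hu => ?_⟩, fun u hu c hc => le_rfl⟩
    exact corner_bound (T.size_pos v) (Nat.succ_pos _)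
  obtain ⟨u, hu, hmax⟩ := (T.children v).exists_max_image T.size
    (by obtain ⟨c, hc⟩ := hleaf; exact ⟨c, mem_children.2 hc⟩)
  rw [mem_children] at hu
  choose! Pl hPl hmono using ih
  obtain ⟨S, hS⟩ : ∃ S, S = ∑ c ∈ (T.children v).erase u, T.size c := ⟨_, rfl⟩
  have hsum : 1 + T.size u + S = T.size v := by rw [hS]; exact sum_erase_size hu
  -- The heaviest child goes `m` columns to the right in the row of `v`, leaving `S` columns for the
  -- other subtrees beneath this edge; the maximum with `1` keeps it distinct from `v` when `S = 0`.
  obtain ⟨m, hm⟩ : ∃ m : ℕ, m = max 1 S := ⟨_, rfl⟩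
  have hm1 : 1 ≤ m := by omega
  have hmS : S ≤ m := by omega
  have hm1' : (1 : ℝ) ≤ m := by exact_mod_cast hm1
  have hmS' : (S : ℝ) ≤ m := by exact_mod_cast hmS
  let posu : V → ℤ × ℤ := fun w => aff m 0 0 1 (Pl u w)
  have hposu : posu u = ((m : ℤ), 0) := by simp [posu, (hPl u hu).root, aff]
  have flat : ∀ z ∈ seg 0 (posu u), z.2 = 0 ∧ ((m : ℝ) ≤ z.1 → z = toPlane (posu u)) := by
    intro z hz
    rw [hposu] at hz ⊢
    obtain ⟨t, t0, t1, hx, hy⟩ := mem_seg.1 hz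
    simp only [Prod.fst_zero, Prod.snd_zero, Int.cast_zero, sub_zero, Int.cast_natCast,
      zero_add, mul_zero] at hx hy
    refine ⟨hy, fun h => ?_⟩
    have : t = 1 := by
      rw [hx] at h
      nlinarith
    subst this
    ext
    · simp [hx, toPlane]
    · simp [hy, toPlane]
  have hrow := exists_row (T := T) hu (p := 0) (X₀ := 0) (h := Nat.log 2 (T.size v)) (S := S)
    (posu := posu) (R := T.body posu u) (Pl := Pl) (hPl u hu).draws.shift subset_rfl ?_ ?_ hS ?_ ?_
    ?_ ?_
  · obtain ⟨pos, g1, g2, g3, g4, g5⟩ := hrow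
    have hb : ∀ c, T.child v c → ∀ w ∈ T.desc c, 0 ≤ (pos w).1 ∧ (pos w).1 < T.size v ∧
        0 ≤ (pos w).2 ∧ (pos w).2 < Nat.log 2 (T.size v) + 1 := by
      intro c hc w hw
      by_cases hcu : c = u
      · subst hcu
        rw [g3 w hw]
        obtain ⟨b1, b2, b3, b4⟩ := (hPl c hc).bound w hw
        have := Nat.log_mono_right (b := 2) (T.size_lt_of_child hc).le
        simp only [posu, aff]
        omega
      · obtain ⟨X, hX1, hX2, hX3⟩ := g4 c hc hcu
        rw [hX3 w hw]
        obtain ⟨b1, b2, b3, b4⟩ := (hPl c hc).bound w hw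
        have := log_size_lt hu hc hcu (hmax c (mem_children.2 hc))
        simp only [aff, Prod.snd_zero]
        omega
    refine ⟨pos, ⟨g1, g2, fun w hw => ?_⟩, fun w hw d hwd => ?_⟩
    · rcases mem_desc_iff.1 hw with rfl | ⟨c, hc, hw⟩
      · rw [g2]
        exact corner_bound (T.size_pos w) (Nat.succ_pos _)
      · exact_mod_cast hb c hc w hw
    · rcases mem_desc_iff.1 hw with rfl | ⟨c, hc, hw⟩
      · rw [g2]
        exact (hb d hwd d (self_mem_desc d)).1
      · have := hmono c hc w hw d hwd
        by_cases hcu : c = u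
        · subst hcu
          rw [g3 w hw, g3 d (child_mem_desc hw hwd)]
          simpa [posu, aff] using this
        · obtain ⟨X, hX1, hX2, hX3⟩ := g4 c hc hcu
          rw [hX3 w hw, hX3 d (child_mem_desc hw hwd)]
          simpa [aff] using this
  · simp [hposu]
  · rw [hposu]
    intro h
    have := congrArg Prod.fst h
    simp at this
    omega
  · intro c hc hcu
    exact (hPl c hc).mono le_rfl (log_size_lt hu hc hcu (hmax c (mem_children.2 hc)))
  · intro z hz hz'
    refine (flat z hz).2 ?_
    have := (hPl u hu).body_shift_subset m 0 hz'
    exact_mod_cast this.1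
  · intro X hX0 hXS z hz
    obtain ⟨t, t0, t1, hx, hy⟩ := mem_seg.1 hz
    simp only [Prod.fst_zero, Prod.snd_zero, Int.cast_zero, sub_zero, zero_add, Int.cast_one,
      mul_one] at hx hy
    constructor
    · intro hz'
      have := ((hPl u hu).body_shift_subset m 0 hz').1
      have hX : (X : ℝ) + 1 ≤ S := by
        have : X + 1 ≤ S := by omega
        exact_mod_cast this
      have hX0' : (0 : ℝ) ≤ X := by exact_mod_cast hX0
      push_cast at this
      nlinarith
    · intro hz'
      have := (flat z hz').1
      have ht : t = 0 := by linarith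
      subst ht
      ext
      · simp [hx, toPlane]
      · simp [hy, toPlane]
  · rintro z ⟨z1, z2, z3, z4⟩
    push_cast at z2
    constructor
    · intro hz'
      have := ((hPl u hu).body_shift_subset m 0 hz').1
      push_cast at this
      linarith
    · intro hz'
      have := (flat z hz').1
      simp only [Prod.snd_zero, Int.cast_zero] at z3
      linarith

end Forest

end TreeDrawing

namespace TreeDrawing

/-! ### Fractions with bounded denominators -/

/-- After taking logarithms, `log (n + 1)` is at most four fifths of `n * log 2`, so one fifth of
the main term in the lower bound for Chebyshev's `ψ` survives. The base case is `243 ≤ 256`. -/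
lemma succ_pow_five_le {n : ℕ} (hn : 2 ≤ n) : (n + 1) ^ 5 ≤ 2 ^ (4 * n) := by
  induction n, hn using Nat.le_induction with
  | base => norm_num
  | succ n hn ih =>
    calc (n + 1 + 1) ^ 5 ≤ (2 * (n + 1)) ^ 5 / 2 := by
          rw [Nat.le_div_iff_mul_le two_pos]
          have h : (n + 2) * 3 ≤ (n + 1) * 4 := by omega
          have h5 := Nat.pow_le_pow_left h 5
          rw [mul_pow, mul_pow] at h5
          rw [mul_pow]
          have : n + 1 + 1 = n + 2 := rfl
          rw [this]
          norm_num at h5 ⊢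
          omega
      _ ≤ 16 * (n + 1) ^ 5 := by
          rw [mul_pow]
          omega
      _ ≤ 16 * 2 ^ (4 * n) := by omega
      _ = 2 ^ (4 * (n + 1)) := by rw [mul_add, pow_add]; norm_num [mul_comm]

/-- A weak form of Chebyshev's lower bound for the number of primes. -/
lemma le_primeCounting {n : ℕ} (hn : 2 ≤ n) :
    n ≤ 5 * (Nat.log 2 n + 1) * Nat.primeCounting n := by
  have h1 := (Chebyshev.psi_ge n).trans (Chebyshev.psi_le_primeCounting_mul_log n)
  have hlog2 : 0 < Real.log 2 := Real.log_pos one_lt_two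
  have h2 : 5 * Real.log (n + 1) ≤ 4 * n * Real.log 2 := by
    have : ((n + 1 : ℕ) : ℝ) ^ 5 ≤ 2 ^ (4 * n) := by exact_mod_cast succ_pow_five_le hn
    have := Real.log_le_log (by positivity) this
    rw [Real.log_pow, Real.log_pow] at this
    push_cast at this
    exact this
  have h3 : Real.log n ≤ (Nat.log 2 n + 1) * Real.log 2 := by
    have : (n : ℝ) ≤ 2 ^ (Nat.log 2 n + 1) := by
      exact_mod_cast (Nat.lt_pow_succ_log_self one_lt_two n).le
    have := Real.log_le_log (by positivity) this
    rw [Real.log_pow] at this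
    push_cast at this
    exact this
  have h4 : (n : ℝ) * Real.log 2 ≤
      (5 * (Nat.log 2 n + 1) * Nat.primeCounting n) * Real.log 2 := by
    have := mul_le_mul_of_nonneg_left h3 (Nat.cast_nonneg (α := ℝ) (Nat.primeCounting n))
    linarith
  exact_mod_cast le_of_mul_le_mul_right h4 hlog2

/-- Some fraction with denominator in `[a, K]` has its value in `[j / K ^ 2, (j + 1) / K ^ 2)`. -/
def GoodCell (a K j : ℕ) : Prop :=
  ∃ p q : ℕ, a ≤ q ∧ 0 < q ∧ q ≤ K ∧ j * q ≤ p * K ^ 2 ∧ p * K ^ 2 < (j + 1) * q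

/-- At most `a - 1` primes lie below `a`, so discarding them is harmless when `a` is about half the
prime count. -/
lemma card_primes_Icc {a K : ℕ} (ha : 0 < a) :
    Nat.primeCounting K + 1 ≤ ((Finset.Icc a K).filter Nat.Prime).card + a := by
  have h1 : (Finset.range (K + 1)).filter Nat.Prime ⊆
      (Finset.Icc a K).filter Nat.Prime ∪ Finset.Ico 1 a := by
    intro q hq
    simp only [Finset.mem_filter, Finset.mem_range, Finset.mem_union, Finset.mem_Icc,
      Finset.mem_Ico] at hq ⊢
    have := hq.2.pos
    by_cases h : a ≤ q
    · exact Or.inl ⟨⟨h, by omega⟩, hq.2⟩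
    · exact Or.inr ⟨this, by omega⟩
  have h2 := (Finset.card_le_card h1).trans (Finset.card_union_le _ _)
  rw [← Nat.count_eq_card_filter_range, Nat.card_Ico] at h2
  rw [Nat.primeCounting_eq_primeCounting'_succ, Nat.primeCounting']
  omega

-- A block of `J` cells has length at least `2 / a`, so for each prime `q ≥ a` it contains two
-- consecutive multiples of `1 / q`, one of them in lowest terms. Reduced fractions for different
-- primes are distinct and differ by at least `1 / (q * q') ≥ 1 / K ^ 2`, hence lie in different
-- cells.
open Classical in
lemma card_goodCell_block {a K J : ℕ} (hK : 0 < K) (hJ : 2 * K ^ 2 ≤ J * a) (s : ℕ) :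
    ((Finset.Icc a K).filter Nat.Prime).card ≤
      ((Finset.Ico s (s + J)).filter (GoodCell a K)).card := by
  have hK2 : 0 < K ^ 2 := by positivity
  have hex : ∀ q, a ≤ q → q.Prime → ∃ p, s * q ≤ p * K ^ 2 ∧ p * K ^ 2 < (s + J) * q ∧ ¬ q ∣ p := by
    intro q hq hqp
    -- The least admissible numerator is the ceiling of `s * q / K ^ 2`; if `q` divides it, the next
    -- integer is used.
    have e1 : s * q ≤ (s * q + K ^ 2 - 1) / K ^ 2 * K ^ 2 := by
      have := Nat.lt_div_mul_add (a := s * q + K ^ 2 - 1) hK2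
      omega
    have e2 : (s * q + K ^ 2 - 1) / K ^ 2 * K ^ 2 < s * q + K ^ 2 := by
      have := Nat.div_mul_le_self (s * q + K ^ 2 - 1) (K ^ 2)
      omega
    have e3 : J * a ≤ J * q := Nat.mul_le_mul_left J hq
    have e4 : (s + J) * q = s * q + J * q := add_mul _ _ _
    generalize (s * q + K ^ 2 - 1) / K ^ 2 = p at e1 e2
    by_cases hd : q ∣ p
    · refine ⟨p + 1, by rw [add_mul]; omega, by rw [add_mul]; omega, fun h => ?_⟩
      have := (Nat.dvd_add_right hd).1 h
      exact hqp.one_lt.ne' (Nat.dvd_one.1 this)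
    · exact ⟨p, e1, by omega, hd⟩
  choose! f hf1 hf2 hf3 using hex
  refine Finset.card_le_card_of_injOn (fun q => f q * K ^ 2 / q) ?_ ?_
  · intro q hq
    simp only [Finset.coe_filter, Set.mem_ofPred_eq, Finset.mem_Icc, Finset.mem_Ico] at hq ⊢
    have hq0 := hq.2.pos
    refine ⟨⟨(Nat.le_div_iff_mul_le hq0).2 (hf1 q hq.1.1 hq.2),
      (Nat.div_lt_iff_lt_mul hq0).2 (hf2 q hq.1.1 hq.2)⟩, f q, q, hq.1.1, hq0, hq.1.2,
      Nat.div_mul_le_self _ _, ?_⟩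
    rw [add_mul, one_mul]
    exact Nat.lt_div_mul_add hq0
  -- Fractions in the same cell differ by less than `1 / K ^ 2`, so their cross-multiplied
  -- difference is an integer smaller than one in absolute value.
  · have key : ∀ {q q' : ℕ}, 0 < q → q ≤ K → 0 < q' → q' ≤ K →
        f q * K ^ 2 / q = f q' * K ^ 2 / q' → f q * q' ≤ f q' * q := by
      intro q q' hq hqK hq' hqK' h
      by_contra! hlt
      have e1 := Nat.lt_div_mul_add (a := f q * K ^ 2) hq
      have e2 := Nat.div_mul_le_self (f q' * K ^ 2) q'
      rw [h] at e1
      generalize f q' * K ^ 2 / q' = j at e1 e2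
      have e3 : q * q' ≤ K ^ 2 := by rw [sq]; exact Nat.mul_le_mul hqK hqK'
      have e4 : (f q' * q + 1) * K ^ 2 ≤ (f q * q') * K ^ 2 := Nat.mul_le_mul_right _ hlt
      have e5 := Nat.mul_lt_mul_of_pos_right e1 hq'
      have e6 := Nat.mul_le_mul_right q e2
      nlinarith
    intro q hq q' hq' h
    simp only [Finset.coe_filter, Set.mem_ofPred_eq, Finset.mem_Icc] at hq hq'
    by_contra hne
    have heq : f q * q' = f q' * q := le_antisymm
      (key hq.2.pos hq.1.2 hq'.2.pos hq'.1.2 h) (key hq'.2.pos hq'.1.2 hq.2.pos hq.1.2 h.symm)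
    have hdvd : q ∣ f q * q' := heq ▸ dvd_mul_left _ _
    exact hf3 q hq.1.1 hq.2 (((Nat.coprime_primes hq.2 hq'.2).2 hne).dvd_of_dvd_mul_right hdvd)

open Classical in
lemma le_count_goodCell {a K J : ℕ} (hK : 0 < K) (hJ : 2 * K ^ 2 ≤ J * a) (t : ℕ) :
    t * ((Finset.Icc a K).filter Nat.Prime).card ≤ Nat.count (GoodCell a K) (t * J) := by
  induction t with
  | zero => simp
  | succ t ih =>
    rw [Nat.count_eq_card_filter_range] at ih ⊢
    have h := card_goodCell_block hK hJ (t * J)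
    rw [add_mul, add_mul, one_mul, one_mul]
    refine (add_le_add ih h).trans ?_
    rw [← Finset.card_union_of_disjoint]
    · refine Finset.card_le_card fun j hj => ?_
      simp only [Finset.mem_union, Finset.mem_filter, Finset.mem_range, Finset.mem_Ico] at hj ⊢
      rcases hj with hj | hj
      · exact ⟨by omega, hj.2⟩
      · exact ⟨hj.1.2, hj.2⟩
    · rw [Finset.disjoint_left]
      intro j hj hj'
      simp only [Finset.mem_filter, Finset.mem_range, Finset.mem_Ico] at hj hj'
      omega

/-- There is a sequence of slowly growing fractions with denominators between `a` and `K` that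
are separated by multiples of `1 / K ^ 2`. -/
lemma exists_fractions {a K J : ℕ} (hK : 0 < K) (hJ : 2 * K ^ 2 ≤ J * a)
    (hM : 0 < ((Finset.Icc a K).filter Nat.Prime).card) :
    ∃ p q : ℕ → ℕ, (∀ i, a ≤ q i ∧ 0 < q i ∧ q i ≤ K) ∧
      (∀ i j, i < j → (p i : ℝ) / q i + (j - i - 1 : ℝ) / K ^ 2 ≤ (p j : ℝ) / q j) ∧
      ∀ i, (p i : ℝ) / q i * K ^ 2 ≤
        ((i / ((Finset.Icc a K).filter Nat.Prime).card + 1 : ℕ) : ℝ) * J := by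
  classical
  obtain ⟨M, hM'⟩ : ∃ M, M = ((Finset.Icc a K).filter Nat.Prime).card := ⟨_, rfl⟩
  rw [← hM'] at hM ⊢
  have hcount := le_count_goodCell hK hJ
  have hJ0 : 0 < J := by
    rcases Nat.eq_zero_or_pos J with rfl | h
    · have : 0 < K ^ 2 := by positivity
      omega
    · exact h
  have hinf : {j | GoodCell a K j}.Infinite := by
    refine Set.infinite_of_forall_exists_gt fun n => ?_
    have h := card_goodCell_block hK hJ (n + 1)
    obtain ⟨j, hj⟩ := Finset.card_pos.1 ((hM' ▸ hM).trans_le h)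
    simp only [Finset.mem_filter, Finset.mem_Ico] at hj
    exact ⟨j, hj.2, by omega⟩
  have hgood : ∀ i, GoodCell a K (Nat.nth (GoodCell a K) i) := fun i =>
    Nat.nth_mem_of_infinite hinf i
  -- The `i`-th fraction is taken from the `i`-th good cell. Cell indices grow by at least one each
  -- time, and the position inside a cell costs at most one unit: this is the `- 1` in the
  -- separation.
  choose p q hq1 hq2 hq3 hq4 hq5 using hgood
  have hK' : (0 : ℝ) < (K : ℝ) ^ 2 := by positivity
  have hlow : ∀ i, (Nat.nth (GoodCell a K) i : ℝ) / K ^ 2 ≤ (p i : ℝ) / q i := fun i => by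
    have : (0 : ℝ) < q i := by exact_mod_cast hq2 i
    rw [div_le_div_iff₀ hK' this]
    exact_mod_cast hq4 i
  have hup : ∀ i, (p i : ℝ) / q i ≤ (Nat.nth (GoodCell a K) i + 1 : ℝ) / K ^ 2 := fun i => by
    have : (0 : ℝ) < q i := by exact_mod_cast hq2 i
    rw [div_le_div_iff₀ this hK']
    exact_mod_cast (hq5 i).le
  refine ⟨p, q, fun i => ⟨hq1 i, hq2 i, hq3 i⟩, fun i j hij => ?_, fun i => ?_⟩
  · have h1 : Nat.nth (GoodCell a K) i + (j - i) ≤ Nat.nth (GoodCell a K) j := by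
      have : j - i + Nat.nth (GoodCell a K) i ≤ Nat.nth (GoodCell a K) (j - i + i) :=
        (Nat.nth_strictMono hinf).add_le_nat (j - i) i
      rw [Nat.sub_add_cancel hij.le] at this
      omega
    have h2 : (Nat.nth (GoodCell a K) i + (j - i) : ℝ) ≤ Nat.nth (GoodCell a K) j := by
      have : ((Nat.nth (GoodCell a K) i + (j - i) : ℕ) : ℝ) ≤ Nat.nth (GoodCell a K) j := by
        exact_mod_cast h1
      rwa [Nat.cast_add, Nat.cast_sub hij.le] at this
    calc (p i : ℝ) / q i + (j - i - 1 : ℝ) / K ^ 2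
        ≤ (Nat.nth (GoodCell a K) i + 1 : ℝ) / K ^ 2 + (j - i - 1 : ℝ) / K ^ 2 :=
          add_le_add (hup i) le_rfl
      _ = (Nat.nth (GoodCell a K) i + (j - i) : ℝ) / K ^ 2 := by ring
      _ ≤ (Nat.nth (GoodCell a K) j : ℝ) / K ^ 2 := by gcongr
      _ ≤ _ := hlow j
  · have h1 : Nat.nth (GoodCell a K) i < (i / M + 1) * J := by
      refine Nat.nth_lt_of_lt_count (lt_of_lt_of_le ?_ (hcount _))
      rw [← hM', add_mul, one_mul]
      exact Nat.lt_div_mul_add hM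
    have h2 : (Nat.nth (GoodCell a K) i + 1 : ℝ) ≤ ((i / M + 1 : ℕ) : ℝ) * J := by
      exact_mod_cast h1
    have h3 := hup i
    rw [le_div_iff₀ hK'] at h3
    exact h3.trans h2

end TreeDrawing

namespace TreeDrawing

/-! ### Fans: many parallelograms visible from the origin -/

/-- A finite family can be ranked by decreasing size. -/
lemma exists_antitone_rank {V : Type*} (S : Finset V) (f : V → ℕ) :
    ∃ (r : V → ℕ) (g : ℕ → ℕ), Antitone g ∧ Set.InjOn r S ∧ (∀ c ∈ S, g (r c) = f c) ∧
      (∀ i, g i = 0 ∨ ∃ c ∈ S, g i = f c) ∧ ∀ N, ∑ i ∈ Finset.range N, g i ≤ ∑ c ∈ S, f c := by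
  classical
  let e := S.equivFin
  let σ := Tuple.sort fun i => OrderDual.toDual (f (e.symm i))
  have hσ : Monotone ((fun i => OrderDual.toDual (f (e.symm i : V))) ∘ σ) := Tuple.monotone_sort _
  let r : V → ℕ := fun c => if h : c ∈ S then (σ.symm (e ⟨c, h⟩) : ℕ) else 0
  let g : ℕ → ℕ := fun i => if h : i < S.card then f (e.symm (σ ⟨i, h⟩)) else 0
  have hr : ∀ c (h : c ∈ S), r c = σ.symm (e ⟨c, h⟩) := fun c h => dif_pos h
  have hg : ∀ i (h : i < S.card), g i = f (e.symm (σ ⟨i, h⟩)) := fun i h => dif_pos h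
  have hg0 : ∀ i, ¬ i < S.card → g i = 0 := fun i h => dif_neg h
  refine ⟨r, g, ?_, ?_, ?_, ?_, ?_⟩
  · intro i j hij
    by_cases hj : j < S.card
    · rw [hg i (hij.trans_lt hj), hg j hj]
      exact hσ (show (⟨i, hij.trans_lt hj⟩ : Fin S.card) ≤ ⟨j, hj⟩ from hij)
    · rw [hg0 j hj]
      exact Nat.zero_le _
  · intro c hc c' hc' h
    rw [hr c hc, hr c' hc'] at h
    have := e.injective (σ.symm.injective (Fin.ext h))
    exact congrArg Subtype.val this
  · intro c hc
    rw [hr c hc, hg _ (Fin.is_lt _)]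
    simp
  · intro i
    by_cases hi : i < S.card
    · exact Or.inr ⟨_, (e.symm (σ ⟨i, hi⟩)).2, hg i hi⟩
    · exact Or.inl (hg0 i hi)
  · intro N
    calc ∑ i ∈ Finset.range N, g i ≤ ∑ i ∈ Finset.range (max N S.card), g i :=
          Finset.sum_le_sum_of_subset (Finset.range_subset_range.2 (le_max_left _ _))
      _ = ∑ i ∈ Finset.range S.card, g i := by
          refine (Finset.sum_subset (Finset.range_subset_range.2 (le_max_right _ _)) ?_).symm
          intro i _ hi
          exact hg0 i (by simpa using hi)
      _ = ∑ i : Fin S.card, f (e.symm (σ i)) := by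
          rw [Finset.sum_range]
          exact Finset.sum_congr rfl fun i _ => hg i i.2
      _ = ∑ i : Fin S.card, f (e.symm i) := Equiv.sum_comp σ fun i => f (e.symm i : V)
      _ = ∑ c : S, f c := Equiv.sum_comp e.symm fun c => f (c : V)
      _ = ∑ c ∈ S, f c := Finset.sum_coe_sort S f
      _ ≤ _ := le_rfl

/-- The value at the start of a block is at most every term of the preceding block. So the largest
sizes of all bundles but the first are charged to `1 / K` of the total size. -/
lemma mul_sum_le_of_antitone {g : ℕ → ℕ} (hg : Antitone g) (K N : ℕ) :
    K * ∑ j ∈ Finset.range N, g ((j + 1) * K) ≤ ∑ i ∈ Finset.range (N * K), g i := by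
  induction N with
  | zero => simp
  | succ N ih =>
    rw [Finset.sum_range_succ, mul_add, add_mul, one_mul, Finset.sum_range_add]
    refine add_le_add ih ?_
    calc K * g (N * K + K) = ∑ _i ∈ Finset.range K, g (N * K + K) := by simp
      _ ≤ _ := Finset.sum_le_sum fun i hi => hg (by have := Finset.mem_range.1 hi; omega)

/-- The parallelogram with corner `(X, Y)`, two vertical sides of length `s - 1` and two sides of
slope `m` and horizontal extent `s - 1`. -/
def para (X Y m s : ℕ) : Set (ℝ × ℝ) :=
  {z | X ≤ z.1 ∧ z.1 ≤ X + s - 1 ∧ Y ≤ z.2 - m * (z.1 - X) ∧ z.2 - m * (z.1 - X) ≤ Y + s - 1}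

lemma convex_para (X Y m s : ℕ) : Convex ℝ (para X Y m s) := by
  rintro ⟨x, y⟩ ⟨h1, h2, h3, h4⟩ ⟨x', y'⟩ ⟨h1', h2', h3', h4'⟩ a b ha hb hab
  simp only at h1 h2 h3 h4 h1' h2' h3' h4'
  obtain rfl : b = 1 - a := by linarith
  simp only [para, Set.mem_ofPred_eq, Prod.fst_add, Prod.smul_fst, Prod.snd_add, Prod.smul_snd,
    smul_eq_mul]
  refine ⟨?_, ?_, ?_, ?_⟩
  · linarith [mul_le_mul_of_nonneg_left h1 ha, mul_le_mul_of_nonneg_left h1' hb]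
  · linarith [mul_le_mul_of_nonneg_left h2 ha, mul_le_mul_of_nonneg_left h2' hb]
  · linarith [mul_le_mul_of_nonneg_left h3 ha, mul_le_mul_of_nonneg_left h3' hb]
  · linarith [mul_le_mul_of_nonneg_left h4 ha, mul_le_mul_of_nonneg_left h4' hb]

lemma corner_mem_para {X Y m s : ℕ} (hs : 1 ≤ s) : toPlane ((X : ℤ), (Y : ℤ)) ∈ para X Y m s := by
  have : (1 : ℝ) ≤ s := by exact_mod_cast hs
  simp only [para, toPlane, Set.mem_ofPred_eq, Int.cast_natCast]
  refine ⟨le_rfl, by linarith, by simp, by linarith⟩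

section Bundle

variable {K P Q : ℕ}

/-- The bundle starts at abscissa `K ^ 2`, at the first lattice height strictly above the line of
slope `P / Q` through the origin. -/
lemma bundle_offset (hQ : 0 < Q) :
    (P : ℝ) / Q * K ^ 2 < (P * K ^ 2 / Q + 1 : ℕ) ∧
      ((P * K ^ 2 / Q + 1 : ℕ) : ℝ) ≤ (P : ℝ) / Q * K ^ 2 + 1 := by
  have hQ' : (0 : ℝ) < Q := by exact_mod_cast hQ
  have e1 := Nat.lt_div_mul_add (a := P * K ^ 2) hQ
  have e2 := Nat.div_mul_le_self (P * K ^ 2) Q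
  have e1' : (P * K ^ 2 : ℝ) < (P * K ^ 2 / Q : ℕ) * Q + Q := by exact_mod_cast e1
  have e2' : ((P * K ^ 2 / Q : ℕ) : ℝ) * Q ≤ P * K ^ 2 := by exact_mod_cast e2
  constructor
  · rw [div_mul_eq_mul_div, div_lt_iff₀ hQ']
    push_cast
    linarith
  · rw [div_mul_eq_mul_div, Nat.cast_add, Nat.cast_one, add_le_add_iff_right, le_div_iff₀ hQ']
    exact e2'

/-- The shear is steeper than the direction of the bundle by at least `1`, so edges to later slots
pass beneath the earlier parallelograms, and by at most `2`, so the wedge stays narrow. -/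
lemma bundle_slope (hQ : 0 < Q) :
    (P : ℝ) / Q + 1 ≤ (P / Q + 2 : ℕ) ∧ ((P / Q + 2 : ℕ) : ℝ) ≤ (P : ℝ) / Q + 2 := by
  have hQ' : (0 : ℝ) < Q := by exact_mod_cast hQ
  have e1 := Nat.lt_div_mul_add (a := P) hQ
  have e2 := Nat.div_mul_le_self P Q
  have e1' : (P : ℝ) < (P / Q : ℕ) * Q + Q := by exact_mod_cast e1
  have e2' : ((P / Q : ℕ) : ℝ) * Q ≤ P := by exact_mod_cast e2
  constructor
  · have : (P : ℝ) / Q ≤ (P / Q : ℕ) + 1 := by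
      rw [div_le_iff₀ hQ']
      linarith
    push_cast
    linarith
  · rw [Nat.cast_add, Nat.cast_ofNat, add_le_add_iff_right, le_div_iff₀ hQ']
    exact e2'

/-- The parallelogram in slot `k` of a bundle lies in a narrow wedge. -/
lemma para_subset_wedge (hK : 0 < K) (hQ : 0 < Q) {k s s' : ℕ} (hs : 1 ≤ s) (hs' : s ≤ s')
    {z : ℝ × ℝ} (hz : z ∈ para (K ^ 2 + k * Q) (P * K ^ 2 / Q + 1 + k * P) (P / Q + 2) s) :
    0 < z.1 ∧ (P : ℝ) / Q * z.1 < z.2 ∧ z.2 < ((P : ℝ) / Q + 3 * s' / K ^ 2) * z.1 := by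
  obtain ⟨h1, h2, h3, h4⟩ := hz
  obtain ⟨o1, o2⟩ := bundle_offset (K := K) (P := P) hQ
  obtain ⟨m1, m2⟩ := bundle_slope (P := P) hQ
  have hQ' : (0 : ℝ) < Q := by exact_mod_cast hQ
  have hK2 : (0 : ℝ) < (K : ℝ) ^ 2 := by positivity
  have hsR : (1 : ℝ) ≤ s := by exact_mod_cast hs
  have hsR' : (s : ℝ) ≤ s' := by exact_mod_cast hs'
  rw [Nat.cast_add (_ + 1)] at h3 h4
  generalize ((P * K ^ 2 / Q + 1 : ℕ) : ℝ) = b at *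
  generalize ((P / Q + 2 : ℕ) : ℝ) = m at *
  push_cast at h1 h2 h3 h4
  have hφ : (P : ℝ) / Q * (k * Q) = k * P := by field_simp
  generalize hφ' : (P : ℝ) / Q = φ at *
  have hx : (0 : ℝ) ≤ k * Q := by positivity
  have hx1 : (K : ℝ) ^ 2 ≤ z.1 := by linarith
  have t1 : (1 : ℝ) * (z.1 - (K ^ 2 + k * Q)) ≤ (m - φ) * (z.1 - (K ^ 2 + k * Q)) :=
    mul_le_mul_of_nonneg_right (by linarith) (by linarith)
  have t2 : (m - φ) * (z.1 - (K ^ 2 + k * Q)) ≤ 2 * (z.1 - (K ^ 2 + k * Q)) :=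
    mul_le_mul_of_nonneg_right (by linarith) (by linarith)
  refine ⟨by linarith, by linarith, ?_⟩
  -- Offset, vertical side and excess shear lift the point by less than `3 * s'` above the line of
  -- slope `φ`; since the abscissa is at least `K ^ 2`, this is an angular width of `3 * s' / K ^
  -- 2`.
  have t3 : (3 : ℝ) * s' ≤ 3 * s' / K ^ 2 * z.1 := by
    rw [div_mul_eq_mul_div, le_div_iff₀ hK2]
    exact mul_le_mul_of_nonneg_left hx1 (by linarith)
  linarith

/-- All corners lie on one line of slope `P / Q` passing strictly above the origin, so later corners
are seen at smaller slopes. -/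
lemma bundle_cross (hQ : 0 < Q) {k k' : ℕ} (h : k' < k) :
    (P * K ^ 2 / Q + 1 + k * P) * (K ^ 2 + k' * Q) <
      (P * K ^ 2 / Q + 1 + k' * P) * (K ^ 2 + k * Q) := by
  have e1 := Nat.lt_div_mul_add (a := P * K ^ 2) hQ
  obtain ⟨d, rfl⟩ := Nat.exists_eq_add_of_lt h
  generalize P * K ^ 2 / Q = b at *
  nlinarith

/-- The segment to the corner of slot `k` avoids the parallelograms in the smaller slots. -/
lemma seg_not_mem_para (hK : 0 < K) (hQ : 0 < Q) {k k' s : ℕ} (hkk : k' < k) {z : ℝ × ℝ}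
    (hz : z ∈ seg 0 (((K ^ 2 + k * Q : ℕ) : ℤ), ((P * K ^ 2 / Q + 1 + k * P : ℕ) : ℤ))) :
    z ∉ para (K ^ 2 + k' * Q) (P * K ^ 2 / Q + 1 + k' * P) (P / Q + 2) s := by
  rintro ⟨h1, -, h3, -⟩
  obtain ⟨t, -, -, hx, hy⟩ := mem_seg.1 hz
  have hc : ((P * K ^ 2 / Q + 1 + k * P : ℕ) : ℝ) * (K ^ 2 + k' * Q : ℕ) <
      (P * K ^ 2 / Q + 1 + k' * P : ℕ) * (K ^ 2 + k * Q : ℕ) := by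
    exact_mod_cast bundle_cross hQ hkk
  have hX : (1 : ℝ) ≤ (K ^ 2 + k * Q : ℕ) := by
    have : 0 < K ^ 2 := by positivity
    exact_mod_cast (show 1 ≤ K ^ 2 + k * Q by omega)
  have hm : ((P * K ^ 2 / Q + 1 + k * P : ℕ) : ℝ) ≤ (P / Q + 2 : ℕ) * (K ^ 2 + k * Q : ℕ) := by
    obtain ⟨o1, o2⟩ := bundle_offset (K := K) (P := P) hQ
    obtain ⟨m1, m2⟩ := bundle_slope (P := P) hQ
    have hQ' : (0 : ℝ) < Q := by exact_mod_cast hQ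
    have hφ : (P : ℝ) / Q * (k * Q) = k * P := by field_simp
    have := mul_le_mul_of_nonneg_right m1 (zero_le_one.trans hX)
    rw [Nat.cast_add (_ + 1)]
    have e : ((K ^ 2 + k * Q : ℕ) : ℝ) = K ^ 2 + k * Q := by push_cast; ring
    have e' : ((k * P : ℕ) : ℝ) = k * P := by push_cast; ring
    rw [e] at hX this ⊢
    rw [e']
    nlinarith
  simp only [Prod.fst_zero, Prod.snd_zero, Int.cast_zero, sub_zero, zero_add,
    Int.cast_natCast] at hx hy
  generalize ((P * K ^ 2 / Q + 1 + k * P : ℕ) : ℝ) = Y at *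
  generalize ((K ^ 2 + k * Q : ℕ) : ℝ) = X at *
  generalize ((P * K ^ 2 / Q + 1 + k' * P : ℕ) : ℝ) = Y' at *
  generalize ((K ^ 2 + k' * Q : ℕ) : ℝ) = X' at *
  generalize ((P / Q + 2 : ℕ) : ℝ) = m at *
  -- The edge passes below corner `k'` and has slope at most `m`, whereas the lower side of the
  -- parallelogram leaves that corner with slope `m`; the edge never catches up.
  have a1 : z.2 * X = Y * z.1 := by rw [hx, hy]; ring
  have a2 : (Y' + m * (z.1 - X')) * X ≤ z.2 * X :=
    mul_le_mul_of_nonneg_right (by linarith) (by linarith)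
  have a3 : Y * (z.1 - X') ≤ m * X * (z.1 - X') := mul_le_mul_of_nonneg_right hm (by linarith)
  nlinarith

end Bundle

/-- The segment from the origin to a point with positive first coordinate `X` in an open wedge
stays in the wedge, except for the origin. -/
lemma seg_wedge {X Y : ℤ} {α β : ℝ} (hX : 0 < (X : ℝ)) (h1 : α * X < Y) (h2 : Y < β * X)
    {z : ℝ × ℝ} (hz : z ∈ seg 0 (X, Y)) (hz0 : z ≠ toPlane 0) :
    0 < z.1 ∧ z.1 ≤ X ∧ α * z.1 < z.2 ∧ z.2 < β * z.1 := by
  obtain ⟨t, t0, t1, hx, hy⟩ := mem_seg.1 hz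
  simp only [Prod.fst_zero, Prod.snd_zero, Int.cast_zero, sub_zero, zero_add] at hx hy
  have ht : 0 < t := by
    refine lt_of_le_of_ne t0 fun h => hz0 ?_
    subst h
    ext
    · simp [hx, toPlane]
    · simp [hy, toPlane]
  rw [hx, hy]
  refine ⟨by positivity, by nlinarith, by nlinarith, by nlinarith⟩

/-- Place parallelograms for the elements of `S`, of sizes prescribed by `f`, with all their
corners visible from the origin. -/
lemma exists_fan {V : Type*} (S : Finset V) (f : V → ℕ) {a K : ℕ} (hK : 0 < K)
    {p q : ℕ → ℕ} (hf : ∀ c ∈ S, 1 ≤ f c ∧ f c ≤ a) (hq : ∀ i, a ≤ q i ∧ 0 < q i ∧ q i ≤ K)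
    (hpq : ∀ i j, i < j → (p i : ℝ) / q i + (j - i - 1 : ℝ) / K ^ 2 ≤ (p j : ℝ) / q j) {F : ℝ}
    (hF : ∀ j : ℕ, (K : ℝ) * j ≤ 4 * (a * K + (∑ c ∈ S, f c : ℕ)) → (p j : ℝ) / q j ≤ F) :
    ∃ X Y m : V → ℕ, (∀ c ∈ S, K ^ 2 ≤ X c) ∧ (∀ c ∈ S, X c + f c ≤ 2 * K ^ 2) ∧
      (∀ c ∈ S, ∀ z ∈ para (X c) (Y c) (m c) (f c), 0 ≤ z.2 ∧ z.2 ≤ 2 * K ^ 2 * F) ∧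
      (∀ c ∈ S, ∀ z ∈ seg 0 ((X c : ℤ), (Y c : ℤ)), z ∈ para (X c) (Y c) (m c) (f c) →
        z = toPlane ((X c : ℤ), (Y c : ℤ))) ∧
      (∀ c ∈ S, ∀ c' ∈ S, c ≠ c' → ∀ z ∈ seg 0 ((X c : ℤ), (Y c : ℤ)),
        z ∈ seg 0 ((X c' : ℤ), (Y c' : ℤ)) → z = toPlane 0) ∧
      (∀ c ∈ S, ∀ c' ∈ S, c ≠ c' → ∀ z ∈ seg 0 ((X c : ℤ), (Y c : ℤ)),
        z ∉ para (X c') (Y c') (m c') (f c')) ∧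
      ∀ c ∈ S, ∀ c' ∈ S, c ≠ c' → ∀ z ∈ para (X c) (Y c) (m c) (f c),
        z ∉ para (X c') (Y c') (m c') (f c') := by
  obtain ⟨r, g, hg, hr, hgr, hgS, hsum⟩ := exists_antitone_rank S f
  have hg_le : ∀ i, g i ≤ a := fun i => by
    rcases hgS i with h | ⟨c, hc, h⟩
    · omega
    · rw [h]; exact (hf c hc).2
  -- Bundle `i` uses fraction number `G i`. Its members have ranks from `i * K` on, hence size at
  -- most `g (i * K)`, and skipping four times that many fractions clears its wedge: `4 * g - 1 ≥ 3
  -- * g`.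
  let G : ℕ → ℕ := fun i => ∑ j ∈ Finset.range i, 4 * g (j * K)
  have hG : ∀ i i', i < i' → G i + 4 * g (i * K) ≤ G i' := fun i i' h => by
    have : G (i + 1) = G i + 4 * g (i * K) := Finset.sum_range_succ _ _
    rw [← this]
    exact Finset.sum_le_sum_of_subset (Finset.range_subset_range.2 h)
  have hGle : ∀ i, K * G (i + 1) ≤ 4 * (a * K + ∑ c ∈ S, f c) := fun i => by
    have e : G (i + 1) = 4 * ∑ j ∈ Finset.range i, g ((j + 1) * K) + 4 * g (0 * K) := by
      rw [Finset.mul_sum]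
      exact Finset.sum_range_succ' _ _
    have e1 := (mul_sum_le_of_antitone hg K i).trans (hsum (i * K))
    have e2 := Nat.mul_le_mul_left K (hg_le (0 * K))
    rw [e]
    nlinarith
  -- the bundle and the slot of `c`
  let b : V → ℕ := fun c => r c / K
  let k : V → ℕ := fun c => r c % K
  have hbk : ∀ c ∈ S, ∀ c' ∈ S, c ≠ c' → b c = b c' → k c ≠ k c' := by
    intro c hc c' hc' hne hb hk
    refine hne (hr hc hc' ?_)
    rw [← Nat.div_add_mod (r c) K, ← Nat.div_add_mod (r c') K]
    simp only [b, k] at hb hk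
    rw [hb, hk]
  have hk : ∀ c, k c < K := fun c => Nat.mod_lt _ hK
  have hfg : ∀ c ∈ S, f c ≤ g (b c * K) := fun c hc => by
    rw [← hgr c hc]
    exact hg (Nat.div_mul_le_self _ _)
  let P : V → ℕ := fun c => p (G (b c))
  let Q : V → ℕ := fun c => q (G (b c))
  have hQ : ∀ c, a ≤ Q c ∧ 0 < Q c ∧ Q c ≤ K := fun c => hq _
  let φ : V → ℝ := fun c => (P c : ℝ) / Q c
  let ψ : V → ℝ := fun c => (P c : ℝ) / Q c + 3 * g (b c * K) / K ^ 2
  let X : V → ℕ := fun c => K ^ 2 + k c * Q c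
  let Y : V → ℕ := fun c => P c * K ^ 2 / Q c + 1 + k c * P c
  let m : V → ℕ := fun c => P c / Q c + 2
  have hK2 : (0 : ℝ) < (K : ℝ) ^ 2 := by positivity
  have hK2' : 0 < K ^ 2 := by positivity
  have gap : ∀ c ∈ S, ∀ j, b c < j → ψ c ≤ (p (G j) : ℝ) / q (G j) := by
    intro c hc j hj
    have h1 := hG _ _ hj
    have h2 := (hf c hc).1
    have h3 := hfg c hc
    refine le_trans ?_ (hpq (G (b c)) (G j) (by omega))
    refine add_le_add le_rfl ?_
    refine div_le_div_of_nonneg_right ?_ hK2.le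
    have h4 : ((G (b c) + 4 * g (b c * K) : ℕ) : ℝ) ≤ G j := by exact_mod_cast h1
    have h5 : (1 : ℝ) ≤ g (b c * K) := by exact_mod_cast h2.trans h3
    push_cast at h4
    linarith
  have hψF : ∀ c ∈ S, ψ c ≤ F := fun c hc =>
    (gap c hc _ (Nat.lt_succ_self _)).trans (hF _ (by exact_mod_cast hGle (b c)))
  have wedge : ∀ c ∈ S, ∀ z ∈ para (X c) (Y c) (m c) (f c),
      0 < z.1 ∧ φ c * z.1 < z.2 ∧ z.2 < ψ c * z.1 := fun c hc z hz =>
    para_subset_wedge hK (hQ c).2.1 (hf c hc).1 (hfg c hc) hz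
  have corner : ∀ c ∈ S, toPlane ((X c : ℤ), (Y c : ℤ)) ∈ para (X c) (Y c) (m c) (f c) :=
    fun c hc => corner_mem_para (hf c hc).1
  have segw : ∀ c ∈ S, ∀ z ∈ seg 0 ((X c : ℤ), (Y c : ℤ)), z ≠ toPlane 0 →
      0 < z.1 ∧ z.1 ≤ X c ∧ φ c * z.1 < z.2 ∧ z.2 < ψ c * z.1 := fun c hc z hz hz0 => by
    obtain ⟨w1, w2, w3⟩ := wedge c hc _ (corner c hc)
    have := seg_wedge w1 w2 w3 hz hz0
    rwa [Int.cast_natCast] at this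
  have sep : ∀ c ∈ S, ∀ c' ∈ S, b c ≠ b c' → ∀ z : ℝ × ℝ, 0 < z.1 → φ c * z.1 < z.2 →
      z.2 < ψ c * z.1 → φ c' * z.1 < z.2 → ¬ z.2 < ψ c' * z.1 := by
    intro c hc c' hc' hb z z0 z1 z2 z3 z4
    rcases lt_or_gt_of_ne hb with h | h
    · have := mul_le_mul_of_nonneg_right (gap c hc _ h) z0.le
      exact absurd (z2.trans_le this) (not_lt.2 z3.le)
    · have := mul_le_mul_of_nonneg_right (gap c' hc' _ h) z0.le
      exact absurd (z4.trans_le this) (not_lt.2 z1.le)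
  have samePQ : ∀ {c c'}, b c = b c' → P c = P c' ∧ Q c = Q c' := fun h => by
    simp only [P, Q, h, and_self]
  have slot : ∀ {c c'}, c ∈ S → b c = b c' → k c < k c' → X c + f c ≤ X c' := by
    intro c c' hc hb hkk
    obtain ⟨-, hQQ⟩ := samePQ hb
    have h1 := (hf c hc).2.trans (hQ c).1
    have h2 : (k c + 1) * Q c ≤ k c' * Q c' := by
      rw [hQQ]
      exact Nat.mul_le_mul_right _ hkk
    simp only [X]
    rw [add_mul, one_mul] at h2
    omega
  refine ⟨X, Y, m, ?_, ?_, ?_, ?_, ?_, ?_, ?_⟩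
  · intro c hc
    simp only [X]
    omega
  · intro c hc
    have h1 : (k c + 1) * Q c ≤ K * K := Nat.mul_le_mul (hk c) (hQ c).2.2
    have h2 := (hf c hc).2.trans (hQ c).1
    simp only [X]
    rw [add_mul, one_mul, ← sq] at h1
    omega
  · intro c hc z hz
    obtain ⟨w1, w2, w3⟩ := wedge c hc z hz
    have hφ : 0 ≤ φ c := by positivity
    have hψ : 0 ≤ ψ c := by positivity
    refine ⟨by nlinarith, ?_⟩
    have hx : z.1 ≤ 2 * K ^ 2 := by
      have h1 : (k c + 1) * Q c ≤ K * K := Nat.mul_le_mul (hk c) (hQ c).2.2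
      have h2 := (hf c hc).2.trans (hQ c).1
      have h3 : X c + f c ≤ 2 * K ^ 2 := by
        simp only [X]
        rw [add_mul, one_mul, ← sq] at h1
        omega
      have h4 : (X c + f c : ℝ) ≤ 2 * K ^ 2 := by exact_mod_cast h3
      linarith [hz.2.1]
    have h5 := hψF c hc
    calc z.2 ≤ ψ c * z.1 := w3.le
      _ ≤ F * (2 * K ^ 2) := mul_le_mul h5 hx w1.le (hψ.trans h5)
      _ = _ := by ring
  · intro c hc z hz hz'
    obtain ⟨t, t0, t1, hx, hy⟩ := mem_seg.1 hz
    simp only [Prod.fst_zero, Prod.snd_zero, Int.cast_zero, sub_zero, zero_add,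
      Int.cast_natCast] at hx hy
    have h1 := hz'.1
    have h2 : (0 : ℝ) < X c := by
      have : 0 < X c := by simp only [X]; omega
      exact_mod_cast this
    have ht : t = 1 := by
      rw [hx] at h1
      nlinarith
    subst ht
    ext
    · simp [hx, toPlane]
    · simp [hy, toPlane]
  · intro c hc c' hc' hne z hz hz'
    by_contra h0
    obtain ⟨w1, w2, w3, w4⟩ := segw c hc z hz h0
    obtain ⟨w1', w2', w3', w4'⟩ := segw c' hc' z hz' h0
    by_cases hb : b c = b c'
    · obtain ⟨hP, hQ'⟩ := samePQ hb
      refine h0 (eq_left_of_mem_seg_of_mem_seg ?_ hz hz')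
      simp only [Prod.fst_zero, Prod.snd_zero, sub_zero]
      have hcr : ∀ {c c'}, P c = P c' → Q c = Q c' → k c' < k c → Y c * X c' < Y c' * X c := by
        intro c c' hP hQ' hkk
        have := bundle_cross (K := K) (P := P c) (hQ c).2.1 hkk
        simp only [X, Y, ← hP, ← hQ']
        exact this
      rcases lt_or_gt_of_ne (hbk c hc c' hc' hne hb) with h | h
      · have := hcr hP.symm hQ'.symm h
        intro h'
        have h' : X c * Y c' = X c' * Y c := by exact_mod_cast h'
        nlinarith
      · have := hcr hP hQ' h
        intro h'
        have h' : X c * Y c' = X c' * Y c := by exact_mod_cast h'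
        nlinarith
    · exact sep c hc c' hc' hb z w1 w3 w4 w3' w4'
  · intro c hc c' hc' hne z hz hz'
    obtain ⟨w1', w2', w3'⟩ := wedge c' hc' z hz'
    have h0 : z ≠ toPlane 0 := by
      rintro rfl
      simp [toPlane] at w1'
    obtain ⟨w1, w2, w3, w4⟩ := segw c hc z hz h0
    by_cases hb : b c = b c'
    · obtain ⟨hP, hQ'⟩ := samePQ hb
      rcases lt_or_gt_of_ne (hbk c hc c' hc' hne hb) with h | h
      · have h1 := slot hc hb h
        have h2 : (X c + f c : ℝ) ≤ X c' := by exact_mod_cast h1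
        have h3 : (1 : ℝ) ≤ f c := by exact_mod_cast (hf c hc).1
        linarith [hz'.1]
      · have := seg_not_mem_para (K := K) (P := P c) (s := f c') hK (hQ c).2.1 h hz
        simp only [X, Y, m, ← hP, ← hQ'] at hz'
        exact this hz'
    · exact sep c hc c' hc' hb z w1 w3 w4 w2' w3'
  · intro c hc c' hc' hne z hz hz'
    obtain ⟨w1, w2, w3⟩ := wedge c hc z hz
    obtain ⟨w1', w2', w3'⟩ := wedge c' hc' z hz'
    by_cases hb : b c = b c'
    · rcases lt_or_gt_of_ne (hbk c hc c' hc' hne hb) with h | h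
      · have h2 : (X c + f c : ℝ) ≤ X c' := by exact_mod_cast slot hc hb h
        linarith [hz'.1, hz.2.1]
      · have h2 : (X c' + f c' : ℝ) ≤ X c := by exact_mod_cast slot hc' hb.symm h
        linarith [hz.1, hz'.2.1]
    · exact sep c hc c' hc' hb z w1 w2 w3 w2' w3'

end TreeDrawing

/-! ### One node: a fan of tiny subtrees and a stack of the others -/

namespace TreeDrawing

open Relation

namespace Forest

variable {V : Type*} {T : Forest V}

lemma BoxDraws.pos_rows {pos : V → ℤ × ℤ} {v : V} {w h : ℕ}
    (hb : T.BoxDraws pos v w h) : 0 < h := by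
  obtain ⟨-, -, h1, h2⟩ := hb.bound v (self_mem_desc v)
  omega

/-- The square of side `s - 1` containing the drawing becomes the parallelogram. For horizontal
drawings `h ≤ s` holds because `log₂ s + 1 ≤ s`. -/
lemma body_shear_subset {pos : V → ℤ × ℤ} {c : V} {s h : ℕ} (hb : T.BoxDraws pos c s h)
    (hs : h ≤ s) (X Y m : ℕ) :
    T.body (fun w => aff X Y m 1 (pos w)) c ⊆ para X (Y + m * 0) m s := by
  refine body_subset_of_convex (convex_para _ _ _ _) fun u hu => ?_
  obtain ⟨h1, h2, h3, h4⟩ := hb.bound u hu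
  have h2' : (pos u).1 ≤ s - 1 := by omega
  have h4' : (pos u).2 ≤ s - 1 := by omega
  have e1 : (0 : ℝ) ≤ (pos u).1 := by exact_mod_cast h1
  have e2 : ((pos u).1 : ℝ) ≤ s - 1 := by exact_mod_cast h2'
  have e3 : (0 : ℝ) ≤ (pos u).2 := by exact_mod_cast h3
  have e4 : ((pos u).2 : ℝ) ≤ s - 1 := by exact_mod_cast h4'
  simp only [para, toPlane, aff, Set.mem_ofPred_eq]
  push_cast
  exact ⟨by linarith, by linarith, by linarith, by linarith⟩

open Classical in
/-- Packing in which a distinguished element comes last. -/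
lemma exists_packing_last (S : Finset V) (h : V → ℕ) (u : V) :
    ∃ D : V → ℕ, (∀ c ∈ S, D c + h c ≤ ∑ c ∈ S, h c) ∧
      ∀ c ∈ S, ∀ c' ∈ S, c ≠ c' → D c + h c ≤ D c' ∨ (D c' + h c' ≤ D c ∧ c' ≠ u) := by
  obtain ⟨D, h1, h2⟩ := exists_packing (S.erase u) h
  refine ⟨Function.update D u (∑ c ∈ S.erase u, h c), ?_, ?_⟩
  · intro c hc
    by_cases hcu : c = u
    · subst hcu
      rw [Function.update_self, ← Finset.add_sum_erase _ _ hc, add_comm]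
    · rw [Function.update_of_ne hcu]
      exact (h1 c (Finset.mem_erase.2 ⟨hcu, hc⟩)).trans
        (Finset.sum_le_sum_of_subset (Finset.erase_subset _ _))
  · intro c hc c' hc' hne
    by_cases hcu : c = u
    · subst hcu
      rw [Function.update_self, Function.update_of_ne (Ne.symm hne)]
      exact Or.inr ⟨h1 c' (Finset.mem_erase.2 ⟨Ne.symm hne, hc'⟩), Ne.symm hne⟩
    · by_cases hcu' : c' = u
      · subst hcu'
        rw [Function.update_self, Function.update_of_ne hne]
        exact Or.inl (h1 c (Finset.mem_erase.2 ⟨hne, hc⟩))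
      · rw [Function.update_of_ne hcu, Function.update_of_ne hcu']
        exact (h2 c (Finset.mem_erase.2 ⟨hcu, hc⟩) c' (Finset.mem_erase.2 ⟨hcu', hc'⟩) hne).imp id
          fun h => ⟨h, hcu'⟩

variable [Fintype V]

open Classical in
/-- Draw the small subtrees `S` of the children of `v` in a fan and stack the others below. -/
lemma exists_fan_stack {v u : V} {S : Finset V} {a K : ℕ} (hK : 2 ≤ K)
    (hSa : ∀ c ∈ S, T.size c ≤ a) {p q : ℕ → ℕ} (hq : ∀ i, a ≤ q i ∧ 0 < q i ∧ q i ≤ K)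
    (hpq : ∀ i j, i < j → (p i : ℝ) / q i + (j - i - 1 : ℝ) / K ^ 2 ≤ (p j : ℝ) / q j) {F : ℝ}
    (hF : ∀ j : ℕ, (K : ℝ) * j ≤ 4 * (a * K + (∑ c ∈ S, T.size c : ℕ)) → (p j : ℝ) / q j ≤ F)
    {Y₀ : ℕ} (hY₀ : 2 * K ^ 2 * F ≤ Y₀) {W : ℕ} (hW : 2 * K ^ 2 ≤ W) {w h : V → ℕ}
    {Pb : V → V → ℤ × ℤ} (hPb : ∀ c ∈ T.children v \ S, T.BoxDraws (Pb c) c (w c) (h c))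
    (hw : ∀ c ∈ T.children v \ S, w c ≤ W ∧ (c ≠ u → w c + 1 ≤ W)) :
    ∃ pos : V → ℤ × ℤ, T.BoxDraws pos v W (Y₀ + 1 + ∑ c ∈ T.children v \ S, h c) := by
  have hK2 : 2 ≤ K ^ 2 := by nlinarith
  obtain ⟨X, Y, m, f1, f2, f3, f4, f5, f6, f7⟩ := exists_fan S T.size (by omega)
    (fun c hc => ⟨T.size_pos c, hSa c hc⟩) hq hpq hF
  obtain ⟨D, d1, d2⟩ := exists_packing_last (T.children v \ S) h u
  choose Pl hPl hmono using T.exists_horizontal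
  -- Stacked subtrees start in column `1`, except that of `u`, which comes last and starts in column
  -- `0`. Edges to the others meet column `1` only at their ends, and the vertical edge to `u`
  -- passes left of everything above `u`.
  let o : V → ℕ := fun c => if c = u then 0 else 1
  have ou : ∀ c, o c ≤ 1 := fun c => by simp only [o]; split_ifs <;> omega
  let Z : V → ℕ := fun c => Y₀ + 1 + D c
  let Pos : V → V → ℤ × ℤ := fun c => if c ∈ S then fun w => aff (X c) (Y c) (m c) 1 (Pl c w) else
    fun w => aff (o c) (Z c) 0 1 (Pb c w)
  let R : V → Set (ℝ × ℝ) := fun c => if c ∈ S then para (X c) (Y c) (m c) (T.size c) else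
    {z : ℝ × ℝ | (o c : ℝ) ≤ z.1 ∧ (Z c : ℝ) ≤ z.2 ∧ z.2 ≤ Z c + h c - 1}
  have PS : ∀ {c}, c ∈ S → Pos c = fun w => aff (X c) (Y c) (m c) 1 (Pl c w) := fun h => by
    simp [Pos, h]
  have PN : ∀ {c}, c ∉ S → Pos c = fun w => aff (o c) (Z c) 0 1 (Pb c w) := fun h => by
    simp [Pos, h]
  have RS : ∀ {c}, c ∈ S → R c = para (X c) (Y c) (m c) (T.size c) := fun h => by simp [R, h]
  have RN : ∀ {c}, c ∉ S → R c =
      {z : ℝ × ℝ | (o c : ℝ) ≤ z.1 ∧ (Z c : ℝ) ≤ z.2 ∧ z.2 ≤ Z c + h c - 1} := fun h => by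
    simp [R, h]
  have hN : ∀ {c}, T.child v c → c ∉ S → c ∈ T.children v \ S := fun hc hcS =>
    Finset.mem_sdiff.2 ⟨mem_children.2 hc, hcS⟩
  have PSc : ∀ {c}, c ∈ S → Pos c c = ((X c : ℤ), (Y c : ℤ)) := fun {c} hc => by
    simp [PS hc, (hPl c).root, aff]
  have PNc : ∀ {c}, T.child v c → c ∉ S → Pos c c = ((o c : ℤ), (Z c : ℤ)) := fun {c} hc hcS => by
    simp [PN hcS, (hPb c (hN hc hcS)).root, aff]
  have bodyS : ∀ {c}, c ∈ S → T.body (Pos c) c ⊆ R c := fun {c} hc => by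
    rw [PS hc, RS hc]
    refine body_shear_subset (hPl c) ?_ _ _ _
    exact Nat.log_lt_self 2 (T.size_pos c).ne'
  -- The fan parallelograms stay to the right of column `1`, so the edges to the stack can pass on
  -- their left.
  have Rlow : ∀ {c}, c ∈ S → ∀ z ∈ R c, 2 ≤ z.1 ∧ 0 ≤ z.2 ∧ z.2 ≤ Y₀ := fun {c} hc z hz => by
    rw [RS hc] at hz
    obtain ⟨h1, h2⟩ := f3 c hc z hz
    have h3 : (2 : ℝ) ≤ X c := by exact_mod_cast hK2.trans (f1 c hc)
    exact ⟨h3.trans hz.1, h1, h2.trans hY₀⟩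
  have Ylow : ∀ {c}, c ∈ S → Y c ≤ Y₀ := fun {c} hc => by
    have := (Rlow hc _ (bodyS hc (toPlane_mem_body (self_mem_desc c)))).2.2
    rw [PSc hc] at this
    simpa [toPlane] using this
  have segS : ∀ {c}, c ∈ S → ∀ z ∈ seg 0 (Pos c c), z.2 ≤ Y₀ := fun {c} hc z hz => by
    rw [PSc hc] at hz
    obtain ⟨t, t0, t1, hx, hy⟩ := mem_seg.1 hz
    simp only [Prod.snd_zero, Int.cast_zero, sub_zero, zero_add, Int.cast_natCast] at hy
    have h1 : (Y c : ℝ) ≤ Y₀ := by exact_mod_cast Ylow hc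
    have h2 : (0 : ℝ) ≤ Y c := Nat.cast_nonneg _
    nlinarith
  have segN : ∀ {c}, T.child v c → c ∉ S → ∀ z ∈ seg 0 (Pos c c), ∃ t : ℝ, 0 ≤ t ∧ t ≤ 1 ∧
      z.1 = t * o c ∧ z.2 = t * Z c := fun {c} hc hcS z hz => by
    rw [PNc hc hcS] at hz
    obtain ⟨t, t0, t1, hx, hy⟩ := mem_seg.1 hz
    simp only [Prod.fst_zero, Prod.snd_zero, Int.cast_zero, sub_zero, zero_add,
      Int.cast_natCast] at hx hy
    exact ⟨t, t0, t1, hx, hy⟩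
  have Zpos : ∀ c, (Y₀ + 1 : ℝ) ≤ Z c := fun c => by
    simp only [Z]
    push_cast
    have : (0 : ℝ) ≤ D c := Nat.cast_nonneg _
    linarith
  have Y₀pos : (0 : ℝ) ≤ Y₀ := Nat.cast_nonneg _
  have opos : ∀ c, (0 : ℝ) ≤ o c := fun c => Nat.cast_nonneg _
  have ole : ∀ c, (o c : ℝ) ≤ 1 := fun c => by exact_mod_cast ou c
  have sepN : ∀ {c c'}, T.child v c → T.child v c' → c ∉ S → c' ∉ S → c ≠ c' →
      (Z c : ℝ) + h c ≤ Z c' ∨ ((Z c' : ℝ) + h c' ≤ Z c ∧ c' ≠ u) := by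
    intro c c' hc hc' hcS hcS' hcc
    rcases d2 c (hN hc hcS) c' (hN hc' hcS') hcc with h1 | ⟨h1, h2⟩
    · left
      have : Z c + h c ≤ Z c' := by simp only [Z]; omega
      exact_mod_cast this
    · refine Or.inr ⟨?_, h2⟩
      have : Z c' + h c' ≤ Z c := by simp only [Z]; omega
      exact_mod_cast this
  have hpos : ∀ {c}, T.child v c → c ∉ S → (1 : ℝ) ≤ h c := fun hc hcS => by
    exact_mod_cast (hPb _ (hN hc hcS)).pos_rows
  refine (exists_glue (T := T) (v := v) (p := 0) (Pos := Pos) (R := R)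
    ?_ ?_ ?_ ?_ ?_ ?_ ?_ ?_).elim fun pos ⟨g1, g2, g3, g4⟩ => ?_
  · intro c hc
    by_cases hcS : c ∈ S
    · rw [PS hcS]
      exact (hPl c).draws.shear (Int.natCast_nonneg _) (hmono c)
    · rw [PN hcS]
      exact (hPb c (hN hc hcS)).draws.shift
  · intro c hc
    by_cases hcS : c ∈ S
    · exact bodyS hcS
    · rw [PN hcS, RN hcS]
      refine ((hPb c (hN hc hcS)).body_shift_subset _ _).trans ?_
      rintro z ⟨z1, -, z3, z4⟩
      push_cast at z1 z3 z4
      exact ⟨z1, z3, z4⟩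
  · intro c hc
    by_cases hcS : c ∈ S
    · rw [PSc hcS]; simp
    · rw [PNc hc hcS]; simp
  · intro c hc h0
    by_cases hcS : c ∈ S
    · rw [PSc hcS] at h0
      have h1 := congrArg Prod.fst h0
      have h2 := f1 c hcS
      simp only [Prod.fst_zero] at h1
      omega
    · rw [PNc hc hcS] at h0
      have h1 := congrArg Prod.snd h0
      simp only [Prod.snd_zero, Z] at h1
      omega
  · intro c hc z hz hz'
    by_cases hcS : c ∈ S
    · rw [PSc hcS] at hz ⊢
      rw [RS hcS] at hz'
      exact f4 c hcS z hz hz'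
    · obtain ⟨t, t0, t1, hx, hy⟩ := segN hc hcS z hz
      rw [RN hcS] at hz'
      have h1 := hz'.2.1
      have h2 := Zpos c
      have ht : t = 1 := by
        rw [hy] at h1
        nlinarith
      subst ht
      rw [PNc hc hcS]
      ext
      · simp [hx, toPlane]
      · simp [hy, toPlane]
  · have key : ∀ {c c'}, c ∈ S → T.child v c' → c' ∉ S → ∀ z ∈ seg 0 (Pos c c),
        z ∈ seg 0 (Pos c' c') → z = toPlane 0 := by
      intro c c' hcS hc' hcS' z hz hz'
      refine eq_left_of_mem_seg_of_mem_seg ?_ hz hz'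
      rw [PSc hcS, PNc hc' hcS']
      simp only [Prod.fst_zero, Prod.snd_zero, sub_zero]
      intro h
      have h : X c * Z c' = o c' * Y c := by exact_mod_cast h
      have h1 : X c * Y c < X c * Z c' :=
        Nat.mul_lt_mul_of_pos_left (by have := Ylow hcS; simp only [Z]; omega)
          (by have := f1 c hcS; omega)
      have h2 : o c' * Y c ≤ X c * Y c :=
        Nat.mul_le_mul_right _ ((ou c').trans (by have := f1 c hcS; omega))
      omega
    intro c c' hc hc' hcc z hz hz'
    by_cases hcS : c ∈ S <;> by_cases hcS' : c' ∈ S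
    · rw [PSc hcS] at hz
      rw [PSc hcS'] at hz'
      exact f5 c hcS c' hcS' hcc z hz hz'
    · exact key hcS hc' hcS' z hz hz'
    · exact key hcS' hc hcS z hz' hz
    · refine eq_left_of_mem_seg_of_mem_seg ?_ hz hz'
      rw [PNc hc hcS, PNc hc' hcS']
      simp only [Prod.fst_zero, Prod.snd_zero, sub_zero]
      intro hh
      have hh : o c * Z c' = o c' * Z c := by exact_mod_cast hh
      have hZ : Z c ≠ Z c' := by
        have h1 := (hPb c (hN hc hcS)).pos_rows
        have h2 := (hPb c' (hN hc' hcS')).pos_rows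
        rcases d2 c (hN hc hcS) c' (hN hc' hcS') hcc with h3 | ⟨h3, -⟩ <;>
          simp only [Z] <;> omega
      have hZ0 : ∀ c, 0 < Z c := fun c => by simp only [Z]; omega
      by_cases hcu : c = u
      · have hcu' : c' ≠ u := fun h => hcc (hcu.trans h.symm)
        simp only [o, if_pos hcu, if_neg hcu', zero_mul, one_mul] at hh
        exact (hZ0 c).ne hh
      · by_cases hcu' : c' = u
        · simp only [o, if_neg hcu, if_pos hcu', zero_mul, one_mul] at hh
          exact (hZ0 c').ne' hh
        · simp only [o, if_neg hcu, if_neg hcu', one_mul] at hh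
          exact hZ hh.symm
  · intro c c' hc hc' hcc z hz hz'
    by_cases hcS : c ∈ S <;> by_cases hcS' : c' ∈ S
    · rw [PSc hcS] at hz
      rw [RS hcS'] at hz'
      exact f6 c hcS c' hcS' hcc z hz hz'
    · rw [RN hcS'] at hz'
      have := segS hcS z hz
      linarith [hz'.2.1, Zpos c']
    · obtain ⟨t, t0, t1, hx, hy⟩ := segN hc hcS z hz
      have h1 := (Rlow hcS' z hz').1
      have h2 := opos c
      have h3 := ole c
      nlinarith
    · obtain ⟨t, t0, t1, hx, hy⟩ := segN hc hcS z hz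
      rw [RN hcS'] at hz'
      obtain ⟨h1, h2, h3⟩ := hz'
      rcases sepN hc hc' hcS hcS' hcc with h4 | ⟨h4, h5⟩
      · have h6 := hpos hc hcS
        have h7 := Zpos c
        nlinarith
      · simp only [o, if_neg h5, Nat.cast_one] at h1
        have h6 := opos c
        have h7 := ole c
        have ht : t = 1 := by nlinarith
        subst ht
        linarith
  · intro c c' hc hc' hcc z hz hz'
    by_cases hcS : c ∈ S <;> by_cases hcS' : c' ∈ S
    · rw [RS hcS] at hz
      rw [RS hcS'] at hz'
      exact f7 c hcS c' hcS' hcc z hz hz'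
    · rw [RN hcS'] at hz'
      linarith [(Rlow hcS z hz).2.2, hz'.2.1, Zpos c']
    · rw [RN hcS] at hz
      linarith [(Rlow hcS' z hz').2.2, hz.2.1, Zpos c]
    · rw [RN hcS] at hz
      rw [RN hcS'] at hz'
      rcases sepN hc hc' hcS hcS' hcc with h4 | ⟨h4, h5⟩
      · linarith [hz.2.2, hz'.2.1]
      · linarith [hz.2.1, hz'.2.2]
  · refine ⟨pos, g1, g2, fun x hx => ?_⟩
    generalize ∑ c ∈ T.children v \ S, h c = H at d1 ⊢
    rcases mem_desc_iff.1 hx with rfl | ⟨c, hc, hx⟩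
    · rw [g2]
      exact corner_bound (by omega) (by omega)
    · rw [g3 c hc x hx]
      by_cases hcS : c ∈ S
      · have h1 := (Rlow hcS _ (bodyS hcS (toPlane_mem_body hx))).2
        obtain ⟨h2, h3, -, -⟩ := (hPl c).bound x hx
        have h4 := f2 c hcS
        have h5 : 0 ≤ (Pos c x).2 ∧ (Pos c x).2 ≤ Y₀ := by
          simp only [toPlane] at h1
          exact_mod_cast h1
        have h6 : (Pos c x).1 = (Pl c x).1 + X c := by rw [PS hcS]; rfl
        refine ⟨?_, ?_, h5.1, ?_⟩ <;> omega
      · obtain ⟨h1, h2, h3, h4⟩ := (hPb c (hN hc hcS)).bound x hx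
        have h5 := d1 c (hN hc hcS)
        have h6 : (Pos c x) = ((Pb c x).1 + o c, (Pb c x).2 + Z c) := by
          rw [PN hcS]; simp [aff]
        obtain ⟨h7, h8⟩ := hw c (hN hc hcS)
        rw [h6]
        have h9 : w c + o c ≤ W := by
          simp only [o]
          split_ifs with h
          · omega
          · exact h8 h
        simp only [Z]
        refine ⟨?_, ?_, ?_, ?_⟩ <;> omega

end Forest

end TreeDrawing

/-! ### Runs: chains of nodes with a single large child -/

namespace TreeDrawing

open Relation

lemma eq_toPlane {z : ℝ × ℝ} {p : ℤ × ℤ} (h1 : z.1 = p.1) (h2 : z.2 = p.2) : z = toPlane p :=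
  Prod.ext h1 h2

namespace Forest

variable {V : Type*} {T : Forest V}

/-- A drawing of the subtree rooted at `v` in `W` columns and `H` rows whose first `h + 1` rows
are empty to the right of column `E`, such that the root is visible both from the point just
right of this strip in the first row and from the corner above the drawing. -/
structure RunDraws (T : Forest V) (h : ℕ) (pos : V → ℤ × ℤ) (v : V) (W H E : ℕ) : Prop where
  draws : T.Draws pos v
  bound : ∀ u ∈ T.desc v, 0 ≤ (pos u).1 ∧ (pos u).1 < W ∧ 0 ≤ (pos u).2 ∧ (pos u).2 < H
  rows : h + 1 ≤ H
  root_le : (pos v).1 ≤ E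
  strip : ∀ z ∈ T.body pos v, z.2 < h + 1 → z.1 ≤ E
  right : ∀ z ∈ seg ((E : ℤ) + 1, 0) (pos v), z ∈ T.body pos v → z = toPlane (pos v)
  above : ∀ z ∈ seg (0, -1) (pos v), z ∈ T.body pos v → z = toPlane (pos v)

lemma body_snd_nonneg {pos : V → ℤ × ℤ} {v : V} {b : ℤ} (h : ∀ u ∈ T.desc v, b ≤ (pos u).2) :
    ∀ z ∈ T.body pos v, (b : ℝ) ≤ z.2 := by
  have hc : Convex ℝ {z : ℝ × ℝ | (b : ℝ) ≤ z.2} :=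
    (convex_Ici (b : ℝ)).is_linear_preimage (f := Prod.snd) ⟨fun _ _ => rfl, fun _ _ => rfl⟩
  refine fun z hz => body_subset_of_convex hc (fun u hu => ?_) hz
  simp only [toPlane, Set.mem_ofPred_eq]
  exact_mod_cast h u hu

/-- A run begins by pushing a box drawing below `h + 1` empty rows; its root, in the first column,
is then visible from every point of the strip. -/
lemma BoxDraws.run {h W H : ℕ} {pos : V → ℤ × ℤ} {v : V} (hb : T.BoxDraws pos v W H) :
    T.RunDraws h (fun w => aff 0 (h + 1) 0 1 (pos w)) v W (H + (h + 1)) 0 := by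
  have hroot : aff 0 (h + 1) 0 1 (pos v) = (0, (h : ℤ) + 1) := by simp [hb.root, aff]
  have hlow : ∀ z ∈ T.body (fun w => aff 0 (h + 1) 0 1 (pos w)) v, (h + 1 : ℝ) ≤ z.2 := by
    have := body_snd_nonneg (T := T) (v := v) (b := (h : ℤ) + 1)
      (pos := fun w => aff 0 (h + 1) 0 1 (pos w)) (fun u hu => by
        have := hb.bound u hu
        simp only [aff]
        omega)
    push_cast at this
    exact this
  refine ⟨hb.draws.shift, fun u hu => ?_, by omega, ?_, ?_, ?_, ?_⟩
  · have := hb.bound u hu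
    simp only [aff]
    omega
  · rw [hroot]; simp
  · intro z hz hz2
    linarith [hlow z hz]
  · intro z hz hzb
    have h1 := hlow z hzb
    rw [hroot] at hz ⊢
    obtain ⟨t, t0, t1, hx, hy⟩ := mem_seg.1 hz
    push_cast at hx hy
    have h2 : (0 : ℝ) ≤ h := Nat.cast_nonneg _
    have ht : t = 1 := by
      rw [hy] at h1
      nlinarith
    subst ht
    refine eq_toPlane ?_ ?_
    · rw [hx]; push_cast; ring
    · rw [hy]; push_cast; ring
  · intro z hz hzb
    have h1 := hlow z hzb
    rw [hroot] at hz ⊢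
    obtain ⟨t, t0, t1, hx, hy⟩ := mem_seg.1 hz
    push_cast at hx hy
    have h2 : (0 : ℝ) ≤ h := Nat.cast_nonneg _
    have ht : t = 1 := by
      rw [hy] at h1
      nlinarith
    subst ht
    refine eq_toPlane ?_ ?_
    · rw [hx]; push_cast; ring
    · rw [hy]; push_cast; ring

variable [Fintype V]

open Classical in
/-- Prolong a run by a node all of whose other children have small subtrees. -/
lemma RunDraws.extend {h W H E S : ℕ} {pos : V → ℤ × ℤ} {v u : V} (hu : T.child v u)
    (hr : T.RunDraws h pos u W H E) (hS : S = ∑ c ∈ (T.children v).erase u, T.size c)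
    (hl : ∀ c, T.child v c → c ≠ u → Nat.log 2 (T.size c) + 1 ≤ h) (hW : E + 2 + S ≤ W) :
    ∃ pos', T.RunDraws h pos' v W H (E + 1 + S) := by
  choose Pl hPl hmono using T.exists_horizontal
  have hu0 : (0 : ℝ) ≤ (pos u).2 := by exact_mod_cast (hr.bound u (self_mem_desc u)).2.2.1
  have huE : ((pos u).1 : ℝ) ≤ E := by exact_mod_cast hr.root_le
  have hE0 : (0 : ℝ) ≤ E := Nat.cast_nonneg _
  have hh0 : (0 : ℝ) ≤ h := Nat.cast_nonneg _
  have hS0 : (0 : ℝ) ≤ S := Nat.cast_nonneg _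
  have segu : ∀ z ∈ seg ((E : ℤ) + 1, 0) (pos u), z.1 ≤ E + 1 ∧ 0 ≤ z.2 ∧
      (E + 1 ≤ z.1 → z = toPlane ((E : ℤ) + 1, 0)) := by
    intro z hz
    obtain ⟨t, t0, t1, hx, hy⟩ := mem_seg.1 hz
    push_cast at hx hy
    refine ⟨by nlinarith, by nlinarith, fun h1 => ?_⟩
    have ht : t = 0 := by nlinarith
    subst ht
    refine eq_toPlane ?_ ?_
    · rw [hx]; push_cast; ring
    · rw [hy]; push_cast; ring
  have ray : ∀ X : ℤ, (E : ℤ) + 2 ≤ X → ∀ z ∈ seg ((E : ℤ) + 1, 0) (X, 0 + 1),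
      (E + 1 : ℝ) ≤ z.1 ∧ z.1 ≤ X ∧ 0 ≤ z.2 ∧ z.2 ≤ 1 ∧
        (z.1 ≤ E + 1 ∨ z.2 ≤ 0 → z = toPlane ((E : ℤ) + 1, 0)) := by
    intro X hX z hz
    obtain ⟨t, t0, t1, hx, hy⟩ := mem_seg.1 hz
    push_cast at hx hy
    have hX' : (E + 2 : ℝ) ≤ X := by exact_mod_cast hX
    refine ⟨by nlinarith, by nlinarith, by linarith, by linarith, fun h1 => ?_⟩
    have ht : t = 0 := by
      rcases h1 with h1 | h1
      · nlinarith
      · linarith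
    subst ht
    refine eq_toPlane ?_ ?_
    · rw [hx]; push_cast; ring
    · rw [hy]; push_cast; ring
  -- The run grows to the right along the top row, so children lie to the left of their parents on
  -- it. The new node and its small subtrees use `1 + S` fresh columns, one for each of their nodes.
  refine (exists_row (T := T) hu (p := ((E : ℤ) + 1, 0)) (X₀ := E + 2) (h := h) (S := S)
    (posu := pos) (R := T.body pos u) (Pl := Pl) hr.draws subset_rfl ?_ ?_ hS ?_ hr.right ?_
    ?_).elim fun pos' ⟨g1, g2, g3, g4, g5⟩ => ⟨pos', ?_⟩
  · exact (hr.bound u (self_mem_desc u)).2.2.1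
  · intro h
    have := congrArg Prod.fst h
    have := hr.root_le
    simp only at *
    omega
  · exact fun c hc hcu => (hPl c).mono le_rfl (hl c hc hcu)
  · intro X hX1 hX2 z hz
    obtain ⟨r1, r2, r3, r4, r5⟩ := ray X hX1 z hz
    refine ⟨fun hz' => ?_, fun hz' => r5 (Or.inl (segu z hz').1)⟩
    -- The edges reach height `1`, which the strip condition covers only for `h > 0`. For `h = 0`
    -- there are no other children, and the range of `X` is empty.
    rcases eq_or_lt_of_le hh0 with h0 | h0
    · by_cases hz2 : z.2 < h + 1
      · linarith [hr.strip z hz' hz2]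
      · have := hr.bound u (self_mem_desc u)
        have hcard : S = 0 := by
          rw [hS]
          refine Finset.sum_eq_zero fun c hc => ?_
          obtain ⟨hcu, hc⟩ := Finset.mem_erase.1 hc
          have := hl c (mem_children.1 hc) hcu
          have h0' : h = 0 := by exact_mod_cast h0.symm
          omega
        omega
    · have h1 : (1 : ℝ) ≤ h := by
        have : 0 < h := by exact_mod_cast h0
        exact_mod_cast this
      linarith [hr.strip z hz' (by linarith)]
  · rintro z ⟨z1, z2, z3, z4⟩
    push_cast at z1 z2 z3 z4
    refine ⟨fun hz' => ?_, fun hz' => ?_⟩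
    · linarith [hr.strip z hz' (by linarith)]
    · linarith [(segu z hz').1]
  · have hbound : ∀ w ∈ T.desc v, 0 ≤ (pos' w).1 ∧ (pos' w).1 < W ∧ 0 ≤ (pos' w).2 ∧
        (pos' w).2 < H := by
      intro w hw
      have hrows := hr.rows
      rcases mem_desc_iff.1 hw with rfl | ⟨c, hc, hw⟩
      · rw [g2]
        refine ⟨?_, ?_, ?_, ?_⟩ <;> simp only <;> omega
      · by_cases hcu : c = u
        · subst hcu
          rw [g3 w hw]
          exact hr.bound w hw
        · obtain ⟨X, hX1, hX2, hX3⟩ := g4 c hc hcu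
          obtain ⟨b1, b2, b3, b4⟩ := (hPl c).bound w hw
          have := hl c hc hcu
          rw [hX3 w hw]
          simp only [aff]
          omega
    refine ⟨g1, hbound, hr.rows, by rw [g2]; push_cast; simp, ?_, ?_, ?_⟩
    · intro z hz hz2
      push_cast
      rcases g5 z hz with rfl | h1 | h1 | ⟨X, hX1, hX2, h1⟩ | ⟨h1, h2, -⟩
      · simp only [toPlane]; push_cast; linarith
      · linarith [(segu z h1).1]
      · linarith [hr.strip z h1 hz2]
      · have : X ≤ E + 1 + S := by omega
        have : (X : ℝ) ≤ E + 1 + S := by exact_mod_cast this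
        linarith [(ray X hX1 z h1).2.1]
      · push_cast at h2
        linarith
    · intro z hz hzb
      rw [g2] at hz ⊢
      obtain ⟨t, t0, t1, hx, hy⟩ := mem_seg.1 hz
      push_cast at hx hy
      have hz1 : (E + 1 : ℝ) ≤ z.1 := by nlinarith
      have hz2 : z.2 = 0 := by linarith
      rcases g5 z hzb with h1 | h1 | h1 | ⟨X, hX1, hX2, h1⟩ | ⟨-, -, h1, -⟩
      · exact h1
      · exact (segu z h1).2.2 hz1
      · linarith [hr.strip z h1 (by linarith)]
      · exact (ray X hX1 z h1).2.2.2.2 (Or.inr hz2.le)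
      · push_cast at h1
        linarith
    · intro z hz hzb
      rw [g2] at hz ⊢
      have h0 := body_snd_nonneg (T := T) (v := v) (b := 0) (pos := pos')
        (fun w hw => (hbound w hw).2.2.1) z hzb
      obtain ⟨t, t0, t1, hx, hy⟩ := mem_seg.1 hz
      push_cast at hx hy h0
      have ht : t = 1 := by linarith
      subst ht
      refine eq_toPlane ?_ ?_
      · rw [hx]; push_cast; ring
      · rw [hy]; push_cast; ring

open Classical in
/-- End a run by a node in the corner all of whose other children have small subtrees. -/
lemma RunDraws.top {h W H E S : ℕ} {pos : V → ℤ × ℤ} {v u : V} (hu : T.child v u)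
    (hr : T.RunDraws h pos u W H E) (hS : S = ∑ c ∈ (T.children v).erase u, T.size c)
    (hl : ∀ c, T.child v c → c ≠ u → Nat.log 2 (T.size c) + 1 ≤ h) (hW : E + 1 + S ≤ W) :
    ∃ pos', T.BoxDraws pos' v W (H + 1) := by
  choose Pl hPl hmono using T.exists_horizontal
  have hR0 : ∀ z ∈ T.body pos u, (0 : ℝ) ≤ z.2 := by
    have := body_snd_nonneg (T := T) (v := u) (b := 0) (pos := pos)
      fun w hw => (hr.bound w hw).2.2.1
    push_cast at this
    exact this
  have hu0 : 0 ≤ (pos u).2 := (hr.bound u (self_mem_desc u)).2.2.1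
  have huE : ((pos u).1 : ℝ) ≤ E := by exact_mod_cast hr.root_le
  have hE0 : (0 : ℝ) ≤ E := Nat.cast_nonneg _
  have hh0 : (0 : ℝ) ≤ h := Nat.cast_nonneg _
  -- A new row above the drawing returns the root to the left corner. The small subtrees fill the
  -- rest of the strip, and the final shift by `1` restores nonnegative coordinates.
  refine (exists_row (T := T) hu (p := ((0 : ℤ), -1)) (X₀ := E + 1) (h := h) (S := S)
    (posu := pos) (R := T.body pos u) (Pl := Pl) hr.draws subset_rfl ?_ ?_ hS ?_ hr.above ?_
    ?_).elim fun pos' ⟨g1, g2, g3, g4, g5⟩ => ⟨fun w => aff 0 1 0 1 (pos' w), g1.shift, ?_, ?_⟩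
  · simp only
    omega
  · intro h
    have := congrArg Prod.snd h
    simp only at this
    omega
  · exact fun c hc hcu => (hPl c).mono le_rfl (hl c hc hcu)
  · intro X hX1 hX2 z hz
    have hX1' : (E + 1 : ℝ) ≤ X := by exact_mod_cast hX1
    constructor
    · intro hz'
      obtain ⟨t, t0, t1, hx, hy⟩ := mem_seg.1 hz
      push_cast at hx hy
      have h1 := hR0 z hz'
      have ht : t = 1 := by linarith
      subst ht
      linarith [hr.strip z hz' (by linarith)]
    · intro hz'
      refine eq_left_of_mem_seg_of_mem_seg ?_ hz hz'
      simp only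
      have h1 := hr.root_le
      nlinarith
  · rintro z ⟨z1, z2, z3, z4⟩
    push_cast at z1 z2 z3 z4
    refine ⟨fun hz' => ?_, fun hz' => ?_⟩
    · linarith [hr.strip z hz' (by linarith)]
    · obtain ⟨t, t0, t1, hx, hy⟩ := mem_seg.1 hz'
      push_cast at hx hy
      nlinarith
  · simp [g2, aff]
  · intro w hw
    have hrows := hr.rows
    rcases mem_desc_iff.1 hw with rfl | ⟨c, hc, hw⟩
    · rw [g2]
      refine ⟨?_, ?_, ?_, ?_⟩ <;> simp only [aff] <;> omega
    · by_cases hcu : c = u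
      · subst hcu
        rw [g3 w hw]
        have := hr.bound w hw
        simp only [aff]
        omega
      · obtain ⟨X, hX1, hX2, hX3⟩ := g4 c hc hcu
        obtain ⟨b1, b2, b3, b4⟩ := (hPl c).bound w hw
        have := hl c hc hcu
        rw [hX3 w hw]
        simp only [aff]
        omega

end Forest

end TreeDrawing

/-! ### Parameters of the fan and the height of one node's drawing -/

namespace TreeDrawing

open Relation

/-- The quantity `(log₂ K + 1) ^ 2`, the polylogarithmic factor of the height bounds. -/
def gam (K : ℕ) : ℝ := ((Nat.log 2 K + 1 : ℕ) : ℝ) ^ 2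

lemma one_le_gam (K : ℕ) : 1 ≤ gam K := by
  have : (1 : ℝ) ≤ ((Nat.log 2 K + 1 : ℕ) : ℝ) := by exact_mod_cast Nat.succ_pos _
  exact one_le_pow₀ this

lemma le_gam (K : ℕ) : ((Nat.log 2 K + 1 : ℕ) : ℝ) ≤ gam K := by
  have : (1 : ℝ) ≤ ((Nat.log 2 K + 1 : ℕ) : ℝ) := by exact_mod_cast Nat.succ_pos _
  exact le_self_pow₀ this two_ne_zero

lemma log_succ_le {K n : ℕ} (hn : n ≤ K ^ 2) :
    Nat.log 2 n + 1 ≤ 2 * (Nat.log 2 K + 1) := by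
  rcases Nat.eq_zero_or_pos n with rfl | h
  · simp only [Nat.log_zero_right]
    omega
  · have h1 : n < 2 ^ (2 * (Nat.log 2 K + 1)) := by
      refine hn.trans_lt ?_
      rw [mul_comm, pow_mul]
      exact Nat.pow_lt_pow_left (Nat.lt_pow_succ_log_self one_lt_two K) two_ne_zero
    exact Nat.log_lt_of_lt_pow h.ne' h1

/-- A sequence of fractions as in `exists_fractions` with explicit bounds. -/
lemma exists_fractions' {K : ℕ} (hK : 2 ≤ K) :
    ∃ (a P : ℕ) (p q : ℕ → ℕ), 0 < P ∧ a ≤ P ∧ P ≤ 2 * a ∧ P ≤ K ∧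
      K ≤ 5 * (Nat.log 2 K + 1) * P ∧ (∀ i, a ≤ q i ∧ 0 < q i ∧ q i ≤ K) ∧
      (∀ i j, i < j → (p i : ℝ) / q i + (j - i - 1 : ℝ) / K ^ 2 ≤ (p j : ℝ) / q j) ∧
      ∀ i, (p i : ℝ) / q i * P ≤ (2 * i / P + 1) * 5 := by
  obtain ⟨P, hP⟩ : ∃ P, P = Nat.primeCounting K := ⟨_, rfl⟩
  have hKP := le_primeCounting hK
  rw [← hP] at hKP
  have hP0 : 0 < P := by
    rcases Nat.eq_zero_or_pos P with h | h
    · rw [h, mul_zero] at hKP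
      omega
    · exact h
  have hPK : P ≤ K := by
    have h1 := card_primes_Icc (a := 1) (K := K) one_pos
    have h2 := Finset.card_filter_le (Finset.Icc 1 K) Nat.Prime
    rw [Nat.card_Icc] at h2
    omega
  -- Half of the prime count balances the two demands: at least `P / 2` primes remain in `[a, K]`,
  -- and `a` is still of order at least `K / log K`.
  obtain ⟨a, ha⟩ : ∃ a, a = (P + 1) / 2 := ⟨_, rfl⟩
  have ha0 : 0 < a := by omega
  have hM := card_primes_Icc (a := a) (K := K) ha0
  have hJ : 2 * K ^ 2 ≤ (2 * K ^ 2 / a + 1) * a := by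
    have := Nat.lt_div_mul_add (a := 2 * K ^ 2) ha0
    rw [add_mul, one_mul]
    exact this.le
  obtain ⟨p, q, h1, h2, h3⟩ := exists_fractions (by omega) hJ (by omega)
  refine ⟨a, P, p, q, hP0, by omega, by omega, hPK, hKP, h1, h2, fun i => ?_⟩
  generalize ((Finset.Icc a K).filter Nat.Prime).card = M at *
  have hPR : (0 : ℝ) < P := by exact_mod_cast hP0
  have haR : (0 : ℝ) < a := by exact_mod_cast ha0
  have hM0 : 0 < M := by omega
  have hMR : (0 : ℝ) < M := by exact_mod_cast hM0
  have hMP : (P : ℝ) ≤ 2 * M := by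
    have : P ≤ 2 * M := by omega
    exact_mod_cast this
  have haP : (P : ℝ) ≤ 2 * a := by
    have : P ≤ 2 * a := by omega
    exact_mod_cast this
  have hK2 : (0 : ℝ) < (K : ℝ) ^ 2 := by positivity
  have e1 : ((i / M + 1 : ℕ) : ℝ) ≤ 2 * i / P + 1 := by
    push_cast
    have : ((i / M : ℕ) : ℝ) ≤ (i : ℝ) / M := Nat.cast_div_le
    have h4 : (i : ℝ) / M ≤ 2 * i / P := by
      rw [div_le_div_iff₀ hMR hPR]
      have := mul_le_mul_of_nonneg_left hMP (Nat.cast_nonneg (α := ℝ) i)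
      linarith
    linarith
  have e2 : ((2 * K ^ 2 / a + 1 : ℕ) : ℝ) * P ≤ 5 * K ^ 2 := by
    have h4 : ((2 * K ^ 2 / a : ℕ) : ℝ) ≤ (2 * K ^ 2 : ℝ) / a := by
      have := Nat.cast_div_le (α := ℝ) (m := 2 * K ^ 2) (n := a)
      push_cast at this
      exact this
    have h5 : (2 * K ^ 2 : ℝ) / a * P ≤ 4 * K ^ 2 := by
      rw [div_mul_eq_mul_div, div_le_iff₀ haR]
      nlinarith
    have h6 : (P : ℝ) ≤ K ^ 2 := by
      have : P ≤ K ^ 2 := by nlinarith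
      exact_mod_cast this
    push_cast
    have h7 := mul_le_mul_of_nonneg_right h4 hPR.le
    linarith
  have e3 := mul_le_mul_of_nonneg_right (h3 i) hPR.le
  have e4 : (0 : ℝ) ≤ 2 * i / P + 1 := by positivity
  have e5 : ((i / M + 1 : ℕ) : ℝ) * (((2 * K ^ 2 / a + 1 : ℕ) : ℝ) * P) ≤
      (2 * i / P + 1) * (5 * K ^ 2) := by
    refine mul_le_mul e1 e2 (by positivity) e4
  refine le_of_mul_le_mul_right ?_ hK2
  calc (p i : ℝ) / q i * P * K ^ 2 = (p i : ℝ) / q i * K ^ 2 * P := by ring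
    _ ≤ _ := e3
    _ = ((i / M + 1 : ℕ) : ℝ) * (((2 * K ^ 2 / a + 1 : ℕ) : ℝ) * P) := by ring
    _ ≤ _ := e5
    _ = _ := by ring

namespace Forest

variable {V : Type*} {T : Forest V} [Fintype V]

open Classical in
/-- A drawing of the subtree rooted at `v` from drawings of the large subtrees of its children. -/
lemma exists_special {K : ℕ} (hK : 2 ≤ K) (v u : V) {W : ℕ} (hW : 2 * K ^ 2 ≤ W) {w h : V → ℕ}
    {Pb : V → V → ℤ × ℤ}
    (hPb : ∀ c, T.child v c → K ^ 2 < T.size c → T.BoxDraws (Pb c) c (w c) (h c))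
    (hw : ∀ c, T.child v c → K ^ 2 < T.size c → w c ≤ W ∧ (c ≠ u → w c + 1 ≤ W)) :
    ∃ pos H, T.BoxDraws pos v W H ∧ (H : ℝ) ≤ 452 * gam K * K +
      2020 * gam K / K * (∑ c ∈ (T.children v).filter (fun c => T.size c ≤ K ^ 2), T.size c : ℕ) +
      (∑ c ∈ (T.children v).filter (fun c => ¬ T.size c ≤ K ^ 2), h c : ℕ) := by
  obtain ⟨a, P, p, q, hP0, haP, hPa, hPK, hKP, hq, hpq, hp⟩ := exists_fractions' hK
  choose Pl hPl hmono using T.exists_horizontal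
  let S := (T.children v).filter fun c => T.size c ≤ a
  let w' : V → ℕ := fun c => if T.size c ≤ K ^ 2 then T.size c else w c
  let h' : V → ℕ := fun c => if T.size c ≤ K ^ 2 then Nat.log 2 (T.size c) + 1 else h c
  let Pb' : V → V → ℤ × ℤ := fun c => if T.size c ≤ K ^ 2 then Pl c else Pb c
  have hPb' : ∀ c ∈ T.children v \ S, T.BoxDraws (Pb' c) c (w' c) (h' c) := by
    intro c hc
    by_cases hcK : T.size c ≤ K ^ 2
    · simp only [Pb', w', h', if_pos hcK]
      exact hPl c
    · simp only [Pb', w', h', if_neg hcK]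
      exact hPb c (mem_children.1 (Finset.mem_sdiff.1 hc).1) (not_le.1 hcK)
  have hw' : ∀ c ∈ T.children v \ S, w' c ≤ W ∧ (c ≠ u → w' c + 1 ≤ W) := by
    intro c hc
    by_cases hcK : T.size c ≤ K ^ 2
    · simp only [w', if_pos hcK]
      have : 0 < K ^ 2 := by positivity
      omega
    · simp only [w', if_neg hcK]
      exact hw c (mem_children.1 (Finset.mem_sdiff.1 hc).1) (not_le.1 hcK)
  have hPR : (0 : ℝ) < P := by exact_mod_cast hP0
  have hKR : (0 : ℝ) < K := by
    have : 0 < K := by omega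
    exact_mod_cast this
  have haR : (a : ℝ) ≤ P := by exact_mod_cast haP
  obtain ⟨ℓ, hℓ⟩ : ∃ ℓ, ℓ = Nat.log 2 K + 1 := ⟨_, rfl⟩
  have hgam : gam K = (ℓ : ℝ) ^ 2 := by rw [gam, hℓ]
  have hℓ1 : (1 : ℝ) ≤ ℓ := by
    have : 1 ≤ ℓ := by omega
    exact_mod_cast this
  have hKPR : (K : ℝ) / P ≤ 5 * ℓ := by
    rw [div_le_iff₀ hPR]
    rw [← hℓ] at hKP
    exact_mod_cast hKP
  have hρ0 : 0 ≤ (K : ℝ) / P := by positivity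
  obtain ⟨L, hL⟩ : ∃ L, L = ∑ c ∈ S, T.size c := ⟨_, rfl⟩
  have hL0 : (0 : ℝ) ≤ L := Nat.cast_nonneg _
  -- The fan uses fraction indices up to `4 * P + 4 * L / K`; substituting this in the growth bound
  -- for the fractions gives `F`. With `K / P ≤ 5 * ℓ` the fan height becomes `450 * ℓ * K + 2000 *
  -- ℓ ^ 2 / K * L`.
  obtain ⟨F, hFdef⟩ : ∃ F : ℝ, F = (9 + 8 * L / (K * P)) * 5 / P := ⟨_, rfl⟩
  have hF : ∀ j : ℕ, (K : ℝ) * j ≤ 4 * (a * K + (∑ c ∈ S, T.size c : ℕ)) →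
      (p j : ℝ) / q j ≤ F := by
    intro j hj
    rw [← hL] at hj
    rw [hFdef, le_div_iff₀ hPR]
    refine (hp j).trans ?_
    have h1 : 2 * (j : ℝ) / P ≤ 8 + 8 * L / (K * P) := by
      rw [div_le_iff₀ hPR]
      have e : (8 + 8 * (L : ℝ) / (K * P)) * P = 8 * P + 8 * L / K := by field_simp
      have h2 : (j : ℝ) ≤ 4 * P + 4 * L / K := by
        have e' : 4 * (P : ℝ) + 4 * L / K = (4 * (P * K + L)) / K := by field_simp
        rw [e', le_div_iff₀ hKR]
        nlinarith
      rw [e]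
      have e'' : 8 * (L : ℝ) / K = 2 * (4 * L / K) := by ring
      linarith
    linarith
  have hF2 : 2 * (K : ℝ) ^ 2 * F ≤ 450 * ℓ * K + 2000 * ℓ ^ 2 / K * L := by
    have e : 2 * (K : ℝ) ^ 2 * F = 90 * K * (K / P) + 80 * L / K * (K / P) ^ 2 := by
      rw [hFdef]; field_simp; ring
    have h1 : ((K : ℝ) / P) ^ 2 ≤ (5 * ℓ) ^ 2 := pow_le_pow_left₀ hρ0 hKPR 2
    have h2 := mul_le_mul_of_nonneg_left h1 (show (0 : ℝ) ≤ 80 * L / K by positivity)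
    have h3 := mul_le_mul_of_nonneg_left hKPR (show (0 : ℝ) ≤ 90 * K by positivity)
    rw [e]
    have e3 : 80 * (L : ℝ) / K * (5 * ℓ) ^ 2 = 2000 * ℓ ^ 2 / K * L := by ring
    linarith
  have hY := Nat.le_ceil (2 * (K : ℝ) ^ 2 * F)
  have hF0 : 0 ≤ F := by rw [hFdef]; positivity
  have hY' := Nat.ceil_lt_add_one (show 0 ≤ 2 * (K : ℝ) ^ 2 * F by positivity)
  obtain ⟨pos, hpos⟩ := exists_fan_stack (T := T) (u := u) (S := S) hK
    (fun c hc => (Finset.mem_filter.1 hc).2) hq hpq hF hY hW hPb' hw'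
  refine ⟨pos, _, hpos, ?_⟩
  -- the heights of the subtrees of medium size
  have hmid : ∀ c, T.size c ≤ K ^ 2 → ¬ T.size c ≤ a →
      ((Nat.log 2 (T.size c) + 1 : ℕ) : ℝ) ≤ 2000 * ℓ ^ 2 / K * T.size c := by
    intro c hcK hca
    have h1 := log_succ_le hcK
    rw [← hℓ] at h1
    have h1' : ((Nat.log 2 (T.size c) + 1 : ℕ) : ℝ) ≤ 2 * ℓ := by exact_mod_cast h1
    have h2 : P ≤ 2 * T.size c := by omega
    have h2' : (P : ℝ) ≤ 2 * T.size c := by exact_mod_cast h2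
    have h3 : (K : ℝ) ≤ 5 * ℓ * P := by rwa [div_le_iff₀ hPR] at hKPR
    have h4 : (K : ℝ) ≤ 10 * ℓ * T.size c := by nlinarith
    refine h1'.trans ?_
    rw [div_mul_eq_mul_div, le_div_iff₀ hKR]
    have h5 := mul_le_mul_of_nonneg_left h4 (show (0 : ℝ) ≤ 2 * ℓ by linarith)
    have h6 : (0 : ℝ) ≤ ℓ ^ 2 * T.size c := by positivity
    nlinarith
  have hsplit : ((∑ c ∈ T.children v \ S, h' c : ℕ) : ℝ) + 2000 * ℓ ^ 2 / K * L ≤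
      2000 * ℓ ^ 2 / K * (∑ c ∈ (T.children v).filter (fun c => T.size c ≤ K ^ 2), T.size c : ℕ) +
      (∑ c ∈ (T.children v).filter (fun c => ¬ T.size c ≤ K ^ 2), h c : ℕ) := by
    have haK : a ≤ K ^ 2 := by nlinarith
    have e1 : T.children v \ S = ((T.children v).filter (fun c => T.size c ≤ K ^ 2) \ S) ∪
        (T.children v).filter (fun c => ¬ T.size c ≤ K ^ 2) := by
      ext c
      simp only [S, Finset.mem_sdiff, Finset.mem_union, Finset.mem_filter]
      have : T.size c ≤ a → T.size c ≤ K ^ 2 := fun h => h.trans haK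
      tauto
    have e2 : S ⊆ (T.children v).filter (fun c => T.size c ≤ K ^ 2) := by
      intro c hc
      simp only [S, Finset.mem_filter] at hc ⊢
      exact ⟨hc.1, hc.2.trans haK⟩
    have e3 : Disjoint ((T.children v).filter (fun c => T.size c ≤ K ^ 2) \ S)
        ((T.children v).filter (fun c => ¬ T.size c ≤ K ^ 2)) :=
      (Finset.disjoint_filter_filter_not _ _ _).mono_left Finset.sdiff_subset
    rw [e1, Finset.sum_union e3, ← Finset.sum_sdiff e2, ← hL]
    have e4 : ∑ c ∈ (T.children v).filter (fun c => ¬ T.size c ≤ K ^ 2), h' c =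
        ∑ c ∈ (T.children v).filter (fun c => ¬ T.size c ≤ K ^ 2), h c :=
      Finset.sum_congr rfl fun c hc => if_neg (Finset.mem_filter.1 hc).2
    have e5 : ((∑ c ∈ (T.children v).filter (fun c => T.size c ≤ K ^ 2) \ S, h' c : ℕ) : ℝ) ≤
        2000 * ℓ ^ 2 / K *
          (∑ c ∈ (T.children v).filter (fun c => T.size c ≤ K ^ 2) \ S, T.size c : ℕ) := by
      push_cast
      rw [Finset.mul_sum]
      refine Finset.sum_le_sum fun c hc => ?_
      obtain ⟨hc1, hc2⟩ := Finset.mem_sdiff.1 hc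
      obtain ⟨hc3, hc4⟩ := Finset.mem_filter.1 hc1
      simp only [h', if_pos hc4]
      exact hmid c hc4 fun h => hc2 (Finset.mem_filter.2 ⟨hc3, h⟩)
    rw [e4]
    push_cast at e5 ⊢
    linarith
  have hfin : (452 : ℝ) * ℓ * K ≤ 452 * gam K * K := by
    rw [hgam]
    have : (ℓ : ℝ) ≤ ℓ ^ 2 := le_self_pow₀ hℓ1 two_ne_zero
    nlinarith
  have h2 : (2 : ℝ) ≤ 2 * ℓ * K := by
    have : (1 : ℝ) ≤ K := by
      have : 1 ≤ K := by omega
      exact_mod_cast this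
    nlinarith
  have h3 : 2000 * (ℓ : ℝ) ^ 2 / K *
      (∑ c ∈ (T.children v).filter (fun c => T.size c ≤ K ^ 2), T.size c : ℕ) ≤
      2020 * gam K / K *
      (∑ c ∈ (T.children v).filter (fun c => T.size c ≤ K ^ 2), T.size c : ℕ) := by
    rw [hgam]
    gcongr
    norm_num
  rw [Nat.cast_add, Nat.cast_add, Nat.cast_one]
  linarith

end Forest

end TreeDrawing

/-! ### The potential argument and the main recursion -/

namespace TreeDrawing

open Relation

/-- The bound for the height of the drawing of a tree with `x` nodes. -/
noncomputable def heightBound (K : ℕ) (x : ℝ) : ℝ := 3000 * gam K / K * x - 500 * gam K * K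

lemma heightBound_mono (K : ℕ) : Monotone (heightBound K) := by
  intro x y hxy
  have h0 : 0 ≤ gam K := zero_le_one.trans (one_le_gam K)
  have h1 : 0 ≤ 3000 * gam K / K := by positivity
  have := mul_le_mul_of_nonneg_left hxy h1
  simp only [heightBound]
  linarith

lemma rows_le {K : ℕ} (hK : 2 ≤ K) :
    ((2 * (Nat.log 2 K + 1) : ℕ) : ℝ) + 2 ≤ 2 * gam K * K := by
  have hKR : (2 : ℝ) ≤ K := by exact_mod_cast hK
  have h1 := le_gam K
  have h2 := one_le_gam K
  rw [Nat.cast_mul, Nat.cast_ofNat]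
  nlinarith

namespace Forest

variable {V : Type*} {T : Forest V} [Fintype V]

-- The fixed cost of a fan is absorbed by the potential, so that no additive slack remains at `v`
-- even though every large child brings its own slack from an interrupted run.
open Classical in
lemma exists_box_of_special {K : ℕ} (hK : 2 ≤ K) {v : V} (hv : K ^ 2 < T.size v)
    (ih : ∀ c, T.child v c → K ^ 2 < T.size c → ∃ pos H,
      T.BoxDraws pos c (3 * K ^ 2 + Nat.log 2 (T.size c)) H ∧
        (H : ℝ) ≤ heightBound K (T.size c) + ((2 * (Nat.log 2 K + 1) : ℕ) + 2))
    (hs : ((T.children v).filter fun c => ¬ T.size c ≤ K ^ 2).card ≠ 1 ∨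
      K ^ 2 ≤ ∑ c ∈ (T.children v).filter (fun c => T.size c ≤ K ^ 2), T.size c) :
    ∃ pos H, T.BoxDraws pos v (3 * K ^ 2 + Nat.log 2 (T.size v)) H ∧
        (H : ℝ) ≤ heightBound K (T.size v) := by
  obtain ⟨u, hu⟩ : ∃ u, ∀ c, T.child v c → c ≠ u →
      Nat.log 2 (T.size c) + 1 ≤ Nat.log 2 (T.size v) := by
    by_cases hne : (T.children v).Nonempty
    · obtain ⟨u, hu, hmax⟩ := (T.children v).exists_max_image T.size hne
      exact ⟨u, fun c hc hcu =>
        log_size_lt (mem_children.1 hu) hc hcu (hmax c (mem_children.2 hc))⟩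
    · exact ⟨v, fun c hc _ => (hne ⟨c, mem_children.2 hc⟩).elim⟩
  choose! Pb h hPb hh using ih
  obtain ⟨pos, H, hpos, hH⟩ := exists_special (T := T) hK v u
    (W := 3 * K ^ 2 + Nat.log 2 (T.size v)) (by omega) hPb (fun c hc hcK => by
      have h1 := Nat.log_mono_right (b := 2) (T.size_lt_of_child hc).le
      exact ⟨by omega, fun hcu => by have := hu c hc hcu; omega⟩)
  have hsize : 1 + ∑ c ∈ (T.children v).filter (fun c => T.size c ≤ K ^ 2), T.size c +
      ∑ c ∈ (T.children v).filter (fun c => ¬ T.size c ≤ K ^ 2), T.size c = T.size v := by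
    rw [size_eq v, add_assoc, Finset.sum_filter_add_sum_filter_not]
  obtain ⟨L, hL⟩ : ∃ L, L = ∑ c ∈ (T.children v).filter (fun c => T.size c ≤ K ^ 2), T.size c :=
    ⟨_, rfl⟩
  obtain ⟨B, hB⟩ : ∃ B, B = (T.children v).filter fun c => ¬ T.size c ≤ K ^ 2 := ⟨_, rfl⟩
  rw [← hL, ← hB] at hsize hH
  rw [← hL, ← hB] at hs
  obtain ⟨N, hN⟩ : ∃ N, N = ∑ c ∈ B, T.size c := ⟨_, rfl⟩
  rw [← hN] at hsize
  have hKR : (2 : ℝ) ≤ K := by exact_mod_cast hK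
  have hg := one_le_gam K
  have hr := rows_le hK
  obtain ⟨g, hgdef⟩ : ∃ g, g = gam K := ⟨_, rfl⟩
  obtain ⟨r, hrdef⟩ : ∃ r : ℝ, r = ((2 * (Nat.log 2 K + 1) : ℕ) : ℝ) + 2 := ⟨_, rfl⟩
  rw [← hgdef] at hg hr hH
  have hsum : ((∑ c ∈ B, h c : ℕ) : ℝ) ≤
      3000 * g / K * N - B.card * (500 * g * K) + B.card * r := by
    rw [Nat.cast_sum, hN, Nat.cast_sum, Finset.mul_sum]
    refine (Finset.sum_le_sum (g := fun c => 3000 * g / K * T.size c - 500 * g * K + r)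
      fun c hc => ?_).trans ?_
    · rw [hB] at hc
      obtain ⟨hc1, hc2⟩ := Finset.mem_filter.1 hc
      have := hh c (mem_children.1 hc1) (not_le.1 hc2)
      rw [heightBound, ← hgdef, ← hrdef] at this
      exact this
    · rw [Finset.sum_add_distrib, Finset.sum_sub_distrib, Finset.sum_const, Finset.sum_const,
        nsmul_eq_mul, nsmul_eq_mul]
  have hsizeR : (T.size v : ℝ) = 1 + L + N := by rw [← hsize]; push_cast; ring
  rw [← hrdef] at hr
  obtain ⟨β, hβ⟩ : ∃ β : ℝ, β = g / K := ⟨_, rfl⟩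
  have hβ0 : 0 < β := by rw [hβ]; positivity
  have hβK : β * K ^ 2 = g * K := by rw [hβ]; field_simp
  have e1 : 3000 * g / K = 3000 * β := by rw [hβ]; ring
  have e2 : 2020 * g / K = 2020 * β := by rw [hβ]; ring
  refine ⟨pos, H, hpos, hH.trans ?_⟩
  rw [heightBound, ← hgdef, hsizeR, e1, e2]
  rw [e1] at hsum
  have hL0 : (0 : ℝ) ≤ L := Nat.cast_nonneg _
  have hN0 : (0 : ℝ) ≤ N := Nat.cast_nonneg _
  have hgK : 0 < g * K := by positivity
  have hcard0 : (0 : ℝ) ≤ B.card := Nat.cast_nonneg _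
  have hcr : (B.card : ℝ) * r ≤ B.card * (2 * g * K) := mul_le_mul_of_nonneg_left hr hcard0
  -- The surplus `(3000 - 2020) * β * L ≥ 980 * g * K` exceeds the fan cost `452 * g * K` plus the
  -- potential `500 * g * K` required at `v`; large children only help.
  by_cases hbig : K ^ 2 ≤ L
  · have hbigR : (K : ℝ) ^ 2 ≤ L := by exact_mod_cast hbig
    have h1 : g * K ≤ β * L := by
      rw [← hβK]
      exact mul_le_mul_of_nonneg_left hbigR hβ0.le
    nlinarith
  · have hcard : B.card ≠ 1 := hs.resolve_right hbig
    -- Without large children the subtree would have at most `K ^ 2` nodes. Two or more release at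
    -- least `2 * 498 * g * K`, again more than `952 * g * K`.
    rcases Nat.lt_or_ge B.card 2 with hlt | hge
    · have h0 : B = ∅ := Finset.card_eq_zero.1 (by omega)
      rw [h0, Finset.sum_empty] at hN
      omega
    · have hgeR : (2 : ℝ) ≤ B.card := by exact_mod_cast hge
      nlinarith [mul_nonneg hβ0.le hL0, mul_le_mul_of_nonneg_right hgeR hgK.le]

/-- The main recursion: drawings of large trees. -/
lemma exists_box_and_run {K : ℕ} (hK : 2 ≤ K) (v : V) (hv : K ^ 2 < T.size v) :
    (∃ pos H, T.BoxDraws pos v (3 * K ^ 2 + Nat.log 2 (T.size v)) H ∧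
      (H : ℝ) ≤ heightBound K (T.size v) + ((2 * (Nat.log 2 K + 1) : ℕ) + 2)) ∧
    ∃ pos H E, T.RunDraws (2 * (Nat.log 2 K + 1)) pos v (3 * K ^ 2 + Nat.log 2 (T.size v)) H E ∧
      E < 2 * K ^ 2 ∧
      (H : ℝ) ≤ (2 * (Nat.log 2 K + 1) : ℕ) + 1 + heightBound K (T.size v - E) := by
  classical
  have hK2 : 0 < K ^ 2 := by positivity
  obtain ⟨h, hh⟩ : ∃ h, h = 2 * (Nat.log 2 K + 1) := ⟨_, rfl⟩
  have hh0 : (0 : ℝ) ≤ h := Nat.cast_nonneg _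
  induction v using T.leaf_induction with
  | h v ih =>
  -- A box drawing without slack also starts a new run with `E = 0`.
  have of_box : (∃ pos H, T.BoxDraws pos v (3 * K ^ 2 + Nat.log 2 (T.size v)) H ∧
      (H : ℝ) ≤ heightBound K (T.size v)) →
      (∃ pos H, T.BoxDraws pos v (3 * K ^ 2 + Nat.log 2 (T.size v)) H ∧
      (H : ℝ) ≤ heightBound K (T.size v) + ((2 * (Nat.log 2 K + 1) : ℕ) + 2)) ∧
      ∃ pos H E, T.RunDraws (2 * (Nat.log 2 K + 1)) pos v (3 * K ^ 2 + Nat.log 2 (T.size v)) H E ∧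
      E < 2 * K ^ 2 ∧
      (H : ℝ) ≤ (2 * (Nat.log 2 K + 1) : ℕ) + 1 + heightBound K (T.size v - E) := by
    rintro ⟨pos, H, hpos, hH⟩
    rw [← hh]
    refine ⟨⟨pos, H, hpos, by linarith⟩, _, _, _, hpos.run, by omega, ?_⟩
    push_cast
    rw [sub_zero]
    linarith
  by_cases hs : ((T.children v).filter fun c => ¬ T.size c ≤ K ^ 2).card ≠ 1 ∨
      K ^ 2 ≤ ∑ c ∈ (T.children v).filter (fun c => T.size c ≤ K ^ 2), T.size c
  · exact of_box (exists_box_of_special hK hv (fun c hc hcK => (ih c hc hcK).1) hs)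
  obtain ⟨hcard, hL⟩ := not_or.1 hs
  replace hcard := not_not.1 hcard
  replace hL := not_le.1 hL
  obtain ⟨u, hu⟩ := Finset.card_eq_one.1 hcard
  have hu' : u ∈ (T.children v).filter fun c => ¬ T.size c ≤ K ^ 2 := by
    rw [hu]; exact Finset.mem_singleton_self u
  obtain ⟨huv, huK⟩ := Finset.mem_filter.1 hu'
  rw [mem_children] at huv
  have herase : (T.children v).erase u = (T.children v).filter fun c => T.size c ≤ K ^ 2 := by
    ext c
    rw [Finset.mem_erase, Finset.mem_filter]
    constructor
    · rintro ⟨h1, h2⟩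
      refine ⟨h2, ?_⟩
      by_contra h3
      have : c ∈ ({u} : Finset V) := hu ▸ Finset.mem_filter.2 ⟨h2, h3⟩
      exact h1 (Finset.mem_singleton.1 this)
    · rintro ⟨h1, h2⟩
      exact ⟨fun h => huK (h ▸ h2), h1⟩
  have hlight : ∀ c, T.child v c → c ≠ u → Nat.log 2 (T.size c) + 1 ≤ h := by
    intro c hc hcu
    have : c ∈ (T.children v).erase u := Finset.mem_erase.2 ⟨hcu, mem_children.2 hc⟩
    rw [herase] at this
    rw [hh]
    exact log_succ_le (Finset.mem_filter.1 this).2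
  have hsize := sum_erase_size huv
  obtain ⟨S, hS⟩ : ∃ S, S = ∑ c ∈ (T.children v).erase u, T.size c := ⟨_, rfl⟩
  rw [← herase, ← hS] at hL
  rw [← hS] at hsize
  obtain ⟨-, pos, H, E, hr, hE, hH⟩ := ih u huv (not_le.1 huK)
  rw [← hh] at hr hH
  have hlog := Nat.log_mono_right (b := 2) (T.size_lt_of_child huv).le
  have hr' : T.RunDraws h pos u (3 * K ^ 2 + Nat.log 2 (T.size v)) H E :=
    { hr with bound := fun w hw => by have := hr.bound w hw; omega }
  have hsizeR : (T.size v : ℝ) = 1 + T.size u + S := by rw [← hsize]; push_cast; ring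
  have hS0 : (0 : ℝ) ≤ S := Nat.cast_nonneg _
  -- The strip uses fewer than `2 * K ^ 2` columns and the new small subtrees fewer than `K ^ 2`,
  -- whence the width `3 * K ^ 2`.
  have htop : ∃ pos, T.BoxDraws pos v (3 * K ^ 2 + Nat.log 2 (T.size v)) (H + 1) :=
    hr'.top huv hS hlight (by omega)
  obtain ⟨post, hpost⟩ := htop
  have hHtop : ((H + 1 : ℕ) : ℝ) ≤ heightBound K (T.size v - E) + (h + 2) := by
    have := heightBound_mono K (show (T.size u : ℝ) - E ≤ T.size v - E by linarith)
    push_cast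
    linarith
  -- Short runs are prolonged, and a parent that cannot continue them accepts the slack `h + 2`.
  -- Once the strip holds `K ^ 2` nodes, closing the run frees `3000 * gam K * K`, which covers that
  -- slack, and a fresh run starts.
  by_cases hEK : E < K ^ 2
  · have hext := hr'.extend huv hS hlight (by omega)
    obtain ⟨pos', hpos'⟩ := hext
    rw [← hh]
    refine ⟨⟨post, H + 1, hpost, hHtop.trans ?_⟩, pos', H, _, hpos', by omega, ?_⟩
    · have hE0 : (0 : ℝ) ≤ E := Nat.cast_nonneg _
      have := heightBound_mono K (show (T.size v : ℝ) - E ≤ T.size v by linarith)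
      linarith
    · have e : (T.size v : ℝ) - ((E + 1 + S : ℕ) : ℝ) = T.size u - E := by
        rw [hsizeR]; push_cast; ring
      rw [e]
      exact hH
  · refine of_box ⟨post, H + 1, hpost, hHtop.trans ?_⟩
    have hEK' : (K : ℝ) ^ 2 ≤ E := by exact_mod_cast not_lt.1 hEK
    have h1 := heightBound_mono K
      (show (T.size v : ℝ) - E ≤ T.size v - K ^ 2 by linarith)
    have h2 := rows_le hK
    rw [← hh] at h2
    have hKR : (2 : ℝ) ≤ K := by exact_mod_cast hK
    have hg := one_le_gam K
    have e : heightBound K (T.size v - K ^ 2) = heightBound K (T.size v) - 3000 * (gam K * K) := by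
      simp only [heightBound]
      field_simp
      ring
    have h3 : 0 ≤ gam K * K := by positivity
    linarith

/-- Every tree has a drawing of width `O(K ^ 2 + log n)` and height `O(n / K + K)`, up to
polylogarithmic factors in `K`. -/
lemma exists_box (T : Forest V) {K : ℕ} (hK : 2 ≤ K) (v : V) : ∃ pos H,
    T.BoxDraws pos v (3 * K ^ 2 + Nat.log 2 (T.size v)) H ∧
      (H : ℝ) ≤ 3000 * gam K * (T.size v / K + K) := by
  have hKR : (2 : ℝ) ≤ K := by exact_mod_cast hK
  have hg := one_le_gam K
  have hr := rows_le hK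
  have hgK : 0 ≤ gam K * K := by positivity
  have h0 : 0 ≤ gam K * (T.size v / K) := by positivity
  by_cases hv : K ^ 2 < T.size v
  · obtain ⟨⟨pos, H, hpos, hH⟩, -⟩ := exists_box_and_run (T := T) hK v hv
    refine ⟨pos, H, hpos, hH.trans ?_⟩
    have e : 3000 * gam K / K * (T.size v : ℝ) = 3000 * (gam K * (T.size v / K)) := by ring
    rw [heightBound, e]
    linarith
  · obtain ⟨pos, hpos, -⟩ := T.exists_horizontal v
    refine ⟨pos, _, hpos.mono (by nlinarith) le_rfl, ?_⟩
    have h1 := log_succ_le (not_lt.1 hv)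
    have h2 : ((Nat.log 2 (T.size v) + 1 : ℕ) : ℝ) ≤ (2 * (Nat.log 2 K + 1) : ℕ) := by
      exact_mod_cast h1
    linarith

end Forest

end TreeDrawing

/-! ### From forests back to graphs, and the final estimates -/

namespace TreeDrawing

open Relation

section Tree

variable {V : Type*} {G : SimpleGraph V} {r : V}

lemma isChild_or_isChild (hG : G.IsTree) {u v : V} (h : G.Adj u v) :
    IsChild G r u v ∨ IsChild G r v u := by
  rcases hG.dist_eq_dist_add_one_of_adj r h with h' | h'
  · exact Or.inr ⟨h.symm, h'⟩
  · exact Or.inl ⟨h, h'⟩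

/-- Appending `v` to a shortest walk to a parent gives a path from the root whose penultimate vertex
is that parent; in a tree the path is unique. -/
lemma IsChild.parent_unique (hG : G.IsTree) {u u' v : V} (h : IsChild G r u v)
    (h' : IsChild G r u' v) : u = u' := by
  classical
  have key : ∀ {w}, IsChild G r w v → ∃ p : G.Walk r v, p.IsPath ∧ p.penultimate = w := by
    intro w hw
    obtain ⟨p, hp⟩ := (hG.connected r w).exists_walk_length_eq_dist
    refine ⟨p.concat hw.1, ?_, SimpleGraph.Walk.penultimate_concat _ _⟩
    refine SimpleGraph.Walk.isPath_of_length_eq_dist _ ?_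
    rw [SimpleGraph.Walk.length_concat, hp, hw.2]
  obtain ⟨p, hp, hpu⟩ := key h
  obtain ⟨p', hp', hpu'⟩ := key h'
  have e : p = p' := congrArg Subtype.val
    ((hG.isAcyclic.subsingleton_path r v).elim ⟨p, hp⟩ ⟨p', hp'⟩)
  rw [← hpu, ← hpu', e]

/-- A rooted tree, seen as a forest whose nodes are ranked by the distance from the root. -/
noncomputable def treeForest (hG : G.IsTree) (r : V) : Forest V where
  child := IsChild G r
  rank := G.dist r
  rank_child h := h.2
  parent_unique := IsChild.parent_unique hG

lemma mem_desc_root (hG : G.IsTree) (r v : V) : v ∈ (treeForest hG r).desc r := by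
  induction (SimpleGraph.reachable_iff_reflTransGen r v).1 (hG.connected r v) with
  | refl => exact Forest.self_mem_desc _
  | tail _ hbc ih =>
    rcases isChild_or_isChild (r := r) hG hbc with h | h
    · exact ih.tail h
    · rcases ReflTransGen.cases_tail ih with rfl | ⟨a, ha, hab⟩
      · have := h.2
        rw [SimpleGraph.dist_self] at this
        omega
      · rw [h.parent_unique hG hab]
        exact ha

lemma size_root [Fintype V] (hG : G.IsTree) (r : V) :
    (treeForest hG r).size r = Fintype.card V := by
  simp [Forest.size, mem_desc_root]

/-- A box drawing of a rooted tree, flipped so that the root is at the top. -/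
lemma exists_isPlanarGridDrawing [Fintype V] (hG : G.IsTree) (r : V) {pos : V → ℤ × ℤ} {W H : ℕ}
    (h : (treeForest hG r).BoxDraws pos r W H) :
    ∃ pos, IsPlanarGridDrawing G pos W H ∧ IsUpward G r pos ∧ AtTopLeft r pos := by
  have hmem := mem_desc_root hG r
  have hpl : ∀ u ∈ (treeForest hG r).desc r,
      (treeForest hG r).NodePlanar (fun w => Forest.aff 1 H 0 (-1) (pos w)) u :=
    fun u hu => (h.draws.planar u hu).aff (by norm_num)
  -- The reflection `y ↦ H - y` and the shift `x ↦ x + 1` turn coordinates starting at `0` and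
  -- growing downwards into `{1, …, W} × {1, …, H}` with the root at the top left.
  refine ⟨fun w => Forest.aff 1 H 0 (-1) (pos w), ⟨?_, ?_, ?_, ?_⟩, ?_, ?_⟩
  · intro v
    have := h.bound v (hmem v)
    simp only [Forest.aff, Set.mem_Icc]
    omega
  · exact fun u v huv => Forest.injOn_of_planar r hpl (hmem u) (hmem v) huv
  · intro u v w huv hw
    rcases isChild_or_isChild (r := r) hG huv with hc | hc
    · exact Forest.vertex_on_edge_of_planar r hpl (hmem u) hc (hmem w) hw
    · rw [seg_comm] at hw
      exact (Forest.vertex_on_edge_of_planar r hpl (hmem v) hc (hmem w) hw).symm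
  · have key : ∀ {a b c d : V}, IsChild G r a b → IsChild G r c d → s(a, b) ≠ s(c, d) →
        ∀ p, p ∈ seg (Forest.aff 1 H 0 (-1) (pos a)) (Forest.aff 1 H 0 (-1) (pos b)) →
          p ∈ seg (Forest.aff 1 H 0 (-1) (pos c)) (Forest.aff 1 H 0 (-1) (pos d)) →
          ∃ v, (v = a ∨ v = b) ∧ (v = c ∨ v = d) ∧ p = toPlane (Forest.aff 1 H 0 (-1) (pos v)) := by
      intro a b c d hab hcd hne p hp hp'
      refine Forest.edge_inter_of_planar r hpl (hmem a) hab (hmem c) hcd ?_ hp hp'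
      rintro rfl
      exact hne (by rw [hab.parent_unique hG hcd])
    intro a b c d hab hcd hne p hp hp'
    rcases isChild_or_isChild (r := r) hG hab with h1 | h1 <;>
      rcases isChild_or_isChild (r := r) hG hcd with h2 | h2
    · exact key h1 h2 hne p hp hp'
    · rw [seg_comm] at hp'
      rw [Sym2.eq_swap (a := c)] at hne
      obtain ⟨v, hv, hv', e⟩ := key h1 h2 hne p hp hp'
      exact ⟨v, hv, hv'.symm, e⟩
    · rw [seg_comm] at hp
      rw [Sym2.eq_swap (a := a)] at hne
      obtain ⟨v, hv, hv', e⟩ := key h1 h2 hne p hp hp'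
      exact ⟨v, hv.symm, hv', e⟩
    · rw [seg_comm] at hp hp'
      rw [Sym2.eq_swap (a := a), Sym2.eq_swap (a := c)] at hne
      obtain ⟨v, hv, hv', e⟩ := key h1 h2 hne p hp hp'
      exact ⟨v, hv.symm, hv'.symm, e⟩
  · intro u v huv
    have := h.draws.mono u (hmem u) v huv
    simp only [Forest.aff]
    linarith
  · intro v
    have := h.bound v (hmem v)
    simp only [Forest.aff, h.root, Prod.fst_zero, Prod.snd_zero]
    omega

end Tree

/-! ### Numerical estimates -/

lemma nat_log_two_le (n : ℕ) : (Nat.log 2 n : ℝ) ≤ 2 * Real.log n := by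
  have h1 := Real.log_two_gt_d9
  have h2 : (Nat.log 2 n : ℝ) ≤ Real.logb 2 n := by exact_mod_cast Real.natLog_le_logb n 2
  rw [Real.logb, le_div_iff₀ (by linarith)] at h2
  have h0 : (0 : ℝ) ≤ Nat.log 2 n := Nat.cast_nonneg _
  nlinarith

section Estimates

variable {A : ℝ}

lemma sqrt_le_ceil_add_one (A : ℝ) : √A ≤ ((⌈√A⌉₊ + 1 : ℕ) : ℝ) := by
  have := Nat.le_ceil (√A)
  push_cast
  linarith

lemma ceil_add_one_le (hA : 1 ≤ A) : ((⌈√A⌉₊ + 1 : ℕ) : ℝ) ≤ 3 * √A := by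
  have h1 := Nat.ceil_lt_add_one (Real.sqrt_nonneg A)
  have h2 : 1 ≤ √A := Real.one_le_sqrt.2 hA
  push_cast
  linarith

lemma gam_ceil_le (hA : 1 ≤ A) : gam (⌈√A⌉₊ + 1) ≤ 36 * Real.log (A + 1) ^ 2 := by
  have h1 := nat_log_two_le (⌈√A⌉₊ + 1)
  have h2 := ceil_add_one_le hA
  have h3 : 1 ≤ √A := Real.one_le_sqrt.2 hA
  have h4 := Real.sq_sqrt (zero_le_one.trans hA)
  have h5 : Real.log ((⌈√A⌉₊ + 1 : ℕ) : ℝ) ≤ 2 * Real.log (A + 1) := by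
    rw [← Real.log_rpow (by linarith), Real.rpow_two]
    refine Real.log_le_log (by positivity) (h2.trans ?_)
    nlinarith
  have h6 : 1 / 2 ≤ Real.log (A + 1) := by
    have := Real.log_two_gt_d9
    have := Real.log_le_log (by norm_num) (show (2 : ℝ) ≤ A + 1 by linarith)
    linarith
  rw [gam, show (36 : ℝ) * Real.log (A + 1) ^ 2 = (6 * Real.log (A + 1)) ^ 2 by ring]
  have h0 : (0 : ℝ) ≤ Nat.log 2 (⌈√A⌉₊ + 1) := Nat.cast_nonneg _
  refine pow_le_pow_left₀ (by positivity) ?_ 2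
  push_cast at h1 h5 ⊢
  linarith

lemma div_add_le {n : ℝ} (hA : 1 ≤ A) (hn : A ≤ n) {K : ℝ} (hK : √A ≤ K) (hK' : K ≤ 3 * √A) :
    n / K + K ≤ 4 * (n / √A) := by
  have h1 : 0 < √A := Real.sqrt_pos.2 (by linarith)
  have h2 : n / K ≤ n / √A := div_le_div_of_nonneg_left (by linarith) h1 hK
  have h3 : √A ≤ n / √A := by
    rw [le_div_iff₀ h1, Real.mul_self_sqrt (by linarith)]
    exact hn
  linarith

end Estimates

end TreeDrawing

theorem mainTheorem4 :
    ∃ C : ℝ, 0 < C ∧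
      ∀ (n : ℕ) (A : ℝ), 1 ≤ A → A ≤ (n : ℝ) →
        ∀ (V : Type*) [Fintype V] (G : SimpleGraph V) (r : V),
          G.IsTree → Fintype.card V = n →
            ∃ (W H : ℕ) (pos : V → ℤ × ℤ),
              TreeDrawing.IsPlanarGridDrawing G pos W H ∧
              TreeDrawing.IsUpward G r pos ∧
              TreeDrawing.AtTopLeft r pos ∧
              (W : ℝ) ≤ C * (A + Real.log n) ∧
              (H : ℝ) ≤ C * ((n : ℝ) / Real.sqrt A * Real.log (A + 1) ^ 2) := by
  -- The constant is `3000 * 36 * 4`: from `exists_box`, from `gam_ceil_le`, and from `div_add_le`,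
  -- where `A ≤ n` absorbs the term `K`.
  refine ⟨432000, by norm_num, fun n A hA hAn V _ G r hG hn => ?_⟩
  have hs : 1 ≤ √A := Real.one_le_sqrt.2 hA
  have hK : 2 ≤ ⌈√A⌉₊ + 1 := by
    have := Nat.ceil_pos.2 (zero_lt_one.trans_le hs)
    omega
  obtain ⟨pos, H, hpos, hH⟩ := (TreeDrawing.treeForest hG r).exists_box hK r
  obtain ⟨pos, h1, h2, h3⟩ := TreeDrawing.exists_isPlanarGridDrawing hG r hpos
  refine ⟨_, _, pos, h1, h2, h3, ?_, ?_⟩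
  · have h4 := TreeDrawing.ceil_add_one_le hA
    have h5 := pow_le_pow_left₀ (Nat.cast_nonneg _) h4 2
    rw [mul_pow, Real.sq_sqrt (by linarith)] at h5
    have h6 := TreeDrawing.nat_log_two_le n
    have h7 : 0 ≤ Real.log n := Real.log_natCast_nonneg n
    rw [TreeDrawing.size_root, hn, Nat.cast_add, Nat.cast_mul, Nat.cast_pow, Nat.cast_ofNat]
    linarith
  · rw [TreeDrawing.size_root, hn] at hH
    have h4 := TreeDrawing.gam_ceil_le hA
    have h5 := TreeDrawing.div_add_le hA hAn (TreeDrawing.sqrt_le_ceil_add_one A)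
      (TreeDrawing.ceil_add_one_le hA)
    have h6 : 0 ≤ (n : ℝ) / ((⌈√A⌉₊ + 1 : ℕ) : ℝ) + ((⌈√A⌉₊ + 1 : ℕ) : ℝ) := by positivity
    have h7 := mul_le_mul h4 h5 h6 (by positivity)
    linarith
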